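/- Let $(M,J,g)$ be a compact almost Hermitian manifold and let $(\tilde M,\tilde J,\tilde g)$ be an almost Hermitian manifold. That is, $M$ and $\tilde M$ are smooth manifolds without boundary, $J$ and $\tilde J$ are smooth almost complex structures, and $g$ and $\tilde g$ are smooth Riemannian metrics with $g(JX,JY)=g(X,Y)$ and $\tilde g(\tilde JX,\tilde JY)=\tilde g(X,Y)$. Equip each manifold with its canonical connection $\nabla$, the unique affine connection with $\nabla g=0$, $\nabla J=0$ whose torsion $\tau(X,Y)=\nabla_XY-\nabla_YX-[X,Y]$ has vanishing $(1,1)$-part, i.e. $\tau(X,Y)+\tau(JX,JY)=0$. Let $R(X,Y)Z=\nabla_X\nabla_YZ-\nabla_Y\nabla_XZ-\nabla_{[X,Y]}Z$ be its curvature. The holomorphic sectional curvature in the direction of a nonzero tangent vector $v$ is $$H(v)=\frac{g(R(v,Jv)Jv,v)}{g(v,v)^2};$$ equivalently, it is $g(R(\xi,\bar\xi)\xi,\bar\xi)/g(\xi,\bar\xi)^2$ for the $(1,0)$-vector $\xi=v-\sqrt{-1}\,Jv$. Let $k_1\ge 0$ and $k_2>0$ be real numbers such that the holomorphic sectional curvature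 of $M$ satisfies $H\ge -k_1$ and that of $\tilde M$ satisfies $\tilde H\le -k_2$, at every point and in every direction. Then every almost holomorphic map $f:M\to\tilde M$ (a smooth map with $df\circ J=\tilde J\circ df$) satisfies $$f^*\tilde g\le \frac{k_1}{k_2}\,g,$$ that is, $\tilde g(df(v),df(v))\le \frac{k_1}{k_2}\,g(v,v)$ for every tangent vector $v$ of $M$. -/

import Mathlib

open Bundle VectorField FiberBundle
open scoped Manifold ContDiff

namespace AlmostHermitian
set_option linter.unusedSectionVars false
noncomputable section

/-- A smooth almost complex structure on a smooth manifold `M` (without boundary, modelled on the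
real vector space `E`): a smooth field of endomorphisms `J` of the tangent bundle, `J ^ 2 = -1`. -/
structure AlmostComplexStructure (E : Type*) [NormedAddCommGroup E] [NormedSpace ℝ E]
    (M : Type*) [TopologicalSpace M] [ChartedSpace E M] [IsManifold 𝓘(ℝ, E) ∞ M] where
  J : Π x : M, TangentSpace 𝓘(ℝ, E) x →L[ℝ] TangentSpace 𝓘(ℝ, E) x
  contMDiff : ContMDiff 𝓘(ℝ, E) (𝓘(ℝ, E).prod 𝓘(ℝ, E →L[ℝ] E)) ∞
    (fun x ↦ TotalSpace.mk' (E →L[ℝ] E)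
      (E := fun x : M ↦ TangentSpace 𝓘(ℝ, E) x →L[ℝ] TangentSpace 𝓘(ℝ, E) x) x (J x))
  sq : ∀ (x : M) (v : TangentSpace 𝓘(ℝ, E) x), J x (J x v) = -v

/-- An almost complex structure on the Riemannian manifold `M` (the Riemannian metric `g` is the
inner product `inner ℝ` on the tangent spaces) such that `g` is almost Hermitian:
`g (J u) (J v) = g u v`. -/
structure AlmostHermitianStructure (E : Type*) [NormedAddCommGroup E] [NormedSpace ℝ E]
    (M : Type*) [TopologicalSpace M] [ChartedSpace E M] [IsManifold 𝓘(ℝ, E) ∞ M]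
    [RiemannianBundle (fun x : M ↦ TangentSpace 𝓘(ℝ, E) x)]
    extends AlmostComplexStructure E M where
  inner_J_J : ∀ (x : M) (u v : TangentSpace 𝓘(ℝ, E) x), inner ℝ (J x u) (J x v) = inner ℝ u v

section
variable {E : Type*} [NormedAddCommGroup E] [NormedSpace ℝ E]
  {M : Type*} [TopologicalSpace M] [ChartedSpace E M] [IsManifold 𝓘(ℝ, E) ∞ M]

/-- The vector field `J X`. -/
def AlmostComplexStructure.app (𝒥 : AlmostComplexStructure E M)
    (X : Π x : M, TangentSpace 𝓘(ℝ, E) x) : Π x : M, TangentSpace 𝓘(ℝ, E) x :=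
  fun x ↦ 𝒥.J x (X x)

/-- The real form of the operator `∂̄` on the tangent bundle: under the identification
`Y ↦ (Y - i J Y) / 2` of `TM` with `T^{1,0}M`, this is the `(1,0)`-part of `[X^{0,1}, Y^{1,0}]`. -/
def dbar (𝒥 : AlmostComplexStructure E M) (X Y : Π x : M, TangentSpace 𝓘(ℝ, E) x) (x : M) :
    TangentSpace 𝓘(ℝ, E) x :=
  (1 / 4 : ℝ) • (mlieBracket 𝓘(ℝ, E) X Y x + mlieBracket 𝓘(ℝ, E) (𝒥.app X) (𝒥.app Y) x
    + 𝒥.J x (mlieBracket 𝓘(ℝ, E) (𝒥.app X) Y x) - 𝒥.J x (mlieBracket 𝓘(ℝ, E) X (𝒥.app Y) x))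

variable [RiemannianBundle (fun x : M ↦ TangentSpace 𝓘(ℝ, E) x)]

/-- The metric `g` paired with the canonical connection: `koszul 𝒥 X Y Z = g (∇_X Y) Z`
(see `inner_canonicalConnection`), written out as
`(X g(Y, Z) + (J X) g(Y, J Z)) / 2 + g(∂̄_X Y, Z) - g(Y, ∂̄_X Z)`. -/
def koszul (𝒥 : AlmostComplexStructure E M) (X Y Z : Π x : M, TangentSpace 𝓘(ℝ, E) x) (x : M) : ℝ :=
  (1 / 2 : ℝ) * (mvfderiv 𝓘(ℝ, E) (fun y ↦ (inner ℝ (Y y) (Z y) : ℝ)) x (X x)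
    + mvfderiv 𝓘(ℝ, E) (fun y ↦ (inner ℝ (Y y) (𝒥.app Z y) : ℝ)) x (𝒥.app X x))
  + inner ℝ (dbar 𝒥 X Y x) (Z x) - inner ℝ (Y x) (dbar 𝒥 X Z x)

variable [FiniteDimensional ℝ E]
  [IsContMDiffRiemannianBundle 𝓘(ℝ, E) ∞ E (fun x : M ↦ TangentSpace 𝓘(ℝ, E) x)]
  (𝒥 : AlmostComplexStructure E M) {x : M} {X X' Y Y' Z Z' : Π x : M, TangentSpace 𝓘(ℝ, E) x}
  {f : M → ℝ}

theorem mdiff_app (hX : MDiffAt (T% X) x) : MDiffAt (T% (𝒥.app X)) x :=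
  MDifferentiableAt.clm_bundle_apply (𝒥.contMDiff.mdifferentiable (by simp) x) hX

theorem app_smul : 𝒥.app (f • X) = f • 𝒥.app X := by
  ext x; simp [AlmostComplexStructure.app]
theorem app_add : 𝒥.app (X + Y) = 𝒥.app X + 𝒥.app Y := by
  ext x; simp [AlmostComplexStructure.app]
theorem app_app : 𝒥.app (𝒥.app X) = - X := by
  ext x; simp [AlmostComplexStructure.app, 𝒥.sq]
theorem J_app : 𝒥.J x (X x) = 𝒥.app X x := rfl

instance : FiniteDimensional ℝ (TangentSpace 𝓘(ℝ, E) x) := inferInstanceAs (FiniteDimensional ℝ E)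

theorem mdiff_inner (hX : MDiffAt (T% X) x) (hY : MDiffAt (T% Y) x) :
    MDiffAt (fun y ↦ (inner ℝ (X y) (Y y) : ℝ)) x := by
  exact MDifferentiableAt.inner_bundle (IB := 𝓘(ℝ, E)) (F := E)
    (E := fun x : M ↦ TangentSpace 𝓘(ℝ, E) x) (b := fun x ↦ x) hX hY

theorem dbar_smul_left (hf : MDiffAt f x) (hX : MDiffAt (T% X) x) :
    dbar 𝒥 (f • X) Y x = f x • dbar 𝒥 X Y x := by
  have hJX := mdiff_app 𝒥 hX
  simp only [dbar, app_smul, mlieBracket_smul_left hf hX, mlieBracket_smul_left hf hJX, map_add,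
    map_smul, J_app, app_app, Pi.neg_apply, map_neg, neg_smul]
  module

theorem dbar_smul_right (hf : MDiffAt f x) (hY : MDiffAt (T% Y) x) :
    dbar 𝒥 X (f • Y) x = f x • dbar 𝒥 X Y x +
      (1 / 2 : ℝ) • (mvfderiv 𝓘(ℝ, E) f x (X x) • Y x
        + mvfderiv 𝓘(ℝ, E) f x (𝒥.app X x) • 𝒥.app Y x) := by
  have hJY := mdiff_app 𝒥 hY
  simp only [dbar, app_smul, mlieBracket_smul_right hf hY, mlieBracket_smul_right hf hJY, map_add,
    map_smul, J_app, app_app, Pi.neg_apply]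
  module

theorem dbar_add_left (hX : MDiffAt (T% X) x) (hX' : MDiffAt (T% X') x) :
    dbar 𝒥 (X + X') Y x = dbar 𝒥 X Y x + dbar 𝒥 X' Y x := by
  have hJX := mdiff_app 𝒥 hX
  have hJX' := mdiff_app 𝒥 hX'
  simp only [dbar, app_add, mlieBracket_add_left hX hX', mlieBracket_add_left hJX hJX', map_add]
  module

theorem dbar_add_right (hY : MDiffAt (T% Y) x) (hY' : MDiffAt (T% Y') x) :
    dbar 𝒥 X (Y + Y') x = dbar 𝒥 X Y x + dbar 𝒥 X Y' x := by
  have hJY := mdiff_app 𝒥 hY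
  have hJY' := mdiff_app 𝒥 hY'
  simp only [dbar, app_add, mlieBracket_add_right hY hY', mlieBracket_add_right hJY hJY', map_add]
  module

theorem bracket_neg_right (hY : MDiffAt (T% Y) x) :
    mlieBracket 𝓘(ℝ, E) X (-Y) x = - mlieBracket 𝓘(ℝ, E) X Y x := by
  have := mlieBracket_const_smul_right (I := 𝓘(ℝ, E)) (V := X) (c := (-1 : ℝ)) hY
  simpa using this

theorem bracket_neg_left (hX : MDiffAt (T% X) x) :
    mlieBracket 𝓘(ℝ, E) (-X) Y x = - mlieBracket 𝓘(ℝ, E) X Y x := by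
  have := mlieBracket_const_smul_left (I := 𝓘(ℝ, E)) (W := Y) (c := (-1 : ℝ)) hX
  simpa using this

theorem dbar_app_right (hY : MDiffAt (T% Y) x) :
    dbar 𝒥 X (𝒥.app Y) x = 𝒥.J x (dbar 𝒥 X Y x) := by
  simp only [dbar, app_app, bracket_neg_right hY, map_add, map_sub, map_smul, map_neg, 𝒥.sq]
  module

theorem dbar_app_left (hX : MDiffAt (T% X) x) :
    dbar 𝒥 (𝒥.app X) Y x = - 𝒥.J x (dbar 𝒥 X Y x) := by
  simp only [dbar, app_app, bracket_neg_left hX, map_add, map_sub, map_smul, map_neg, 𝒥.sq]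
  module

theorem dbar_sub_swap :
    (2 : ℝ) • dbar 𝒥 X Y x - (2 : ℝ) • dbar 𝒥 Y X x
      = mlieBracket 𝓘(ℝ, E) X Y x + mlieBracket 𝓘(ℝ, E) (𝒥.app X) (𝒥.app Y) x := by
  simp only [dbar]
  rw [mlieBracket_swap_apply (V := Y) (W := X),
    mlieBracket_swap_apply (V := 𝒥.app Y) (W := 𝒥.app X),
    mlieBracket_swap_apply (V := 𝒥.app Y) (W := X), mlieBracket_swap_apply (V := Y) (W := 𝒥.app X)]
  simp only [map_neg]
  module

variable {𝒥}
theorem inner_J_left (h : ∀ (x : M) (u v : TangentSpace 𝓘(ℝ, E) x),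
    (inner ℝ (𝒥.J x u) (𝒥.J x v) : ℝ) = inner ℝ u v) (u v : TangentSpace 𝓘(ℝ, E) x) :
    (inner ℝ (𝒥.J x u) v : ℝ) = - inner ℝ u (𝒥.J x v) := by
  rw [← h x (𝒥.J x u) v, 𝒥.sq, inner_neg_left]

theorem koszul_smul_left (hf : MDiffAt f x) (hX : MDiffAt (T% X) x) :
    koszul 𝒥 (f • X) Y Z x = f x * koszul 𝒥 X Y Z x := by
  simp only [koszul, app_smul, dbar_smul_left 𝒥 hf hX, Pi.smul_apply', map_smul, inner_smul_left,
    inner_smul_right, smul_eq_mul, conj_trivial]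
  ring

theorem koszul_add_left (hX : MDiffAt (T% X) x) (hX' : MDiffAt (T% X') x) :
    koszul 𝒥 (X + X') Y Z x = koszul 𝒥 X Y Z x + koszul 𝒥 X' Y Z x := by
  simp only [koszul, app_add, dbar_add_left 𝒥 hX hX', Pi.add_apply, map_add, inner_add_left,
    inner_add_right]
  ring

theorem koszul_smul_right (hf : MDiffAt f x) (hY : MDiffAt (T% Y) x) (hZ : MDiffAt (T% Z) x) :
    koszul 𝒥 X Y (f • Z) x = f x * koszul 𝒥 X Y Z x := by
  have hJZ := mdiff_app 𝒥 hZ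
  simp only [koszul, app_smul, dbar_smul_right 𝒥 hf hZ, Pi.smul_apply', inner_smul_right,
    inner_add_right]
  rw [mvfderiv_fun_mul hf (mdiff_inner hY hZ), mvfderiv_fun_mul hf (mdiff_inner hY hJZ)]
  simp only [_root_.add_apply, _root_.smul_apply, smul_eq_mul]
  ring

theorem koszul_add_right (hY : MDiffAt (T% Y) x) (hZ : MDiffAt (T% Z) x)
    (hZ' : MDiffAt (T% Z') x) :
    koszul 𝒥 X Y (Z + Z') x = koszul 𝒥 X Y Z x + koszul 𝒥 X Y Z' x := by
  have hJZ := mdiff_app 𝒥 hZ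
  have hJZ' := mdiff_app 𝒥 hZ'
  simp only [koszul, app_add, dbar_add_right 𝒥 hZ hZ', Pi.add_apply, inner_add_right]
  rw [mvfderiv_fun_add (mdiff_inner hY hZ) (mdiff_inner hY hZ'),
    mvfderiv_fun_add (mdiff_inner hY hJZ) (mdiff_inner hY hJZ')]
  simp only [_root_.add_apply]
  ring

theorem koszul_add_mid (hY : MDiffAt (T% Y) x) (hY' : MDiffAt (T% Y') x)
    (hZ : MDiffAt (T% Z) x) :
    koszul 𝒥 X (Y + Y') Z x = koszul 𝒥 X Y Z x + koszul 𝒥 X Y' Z x := by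
  have hJZ := mdiff_app 𝒥 hZ
  simp only [koszul, dbar_add_right 𝒥 hY hY', Pi.add_apply, inner_add_left]
  rw [mvfderiv_fun_add (mdiff_inner hY hZ) (mdiff_inner hY' hZ),
    mvfderiv_fun_add (mdiff_inner hY hJZ) (mdiff_inner hY' hJZ)]
  simp only [_root_.add_apply]
  ring

theorem koszul_smul_mid (h : ∀ (x : M) (u v : TangentSpace 𝓘(ℝ, E) x),
    (inner ℝ (𝒥.J x u) (𝒥.J x v) : ℝ) = inner ℝ u v) (hf : MDiffAt f x) (hY : MDiffAt (T% Y) x)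
    (hZ : MDiffAt (T% Z) x) :
    koszul 𝒥 X (f • Y) Z x = f x * koszul 𝒥 X Y Z x
      + mvfderiv 𝓘(ℝ, E) f x (X x) * inner ℝ (Y x) (Z x) := by
  have hJZ := mdiff_app 𝒥 hZ
  have e : (inner ℝ (𝒥.app Y x) (Z x) : ℝ) = - inner ℝ (Y x) (𝒥.app Z x) := inner_J_left h _ _
  simp only [koszul, dbar_smul_right 𝒥 hf hY, Pi.smul_apply', inner_add_left, inner_smul_left,
    conj_trivial, e]
  rw [mvfderiv_fun_mul hf (mdiff_inner hY hZ), mvfderiv_fun_mul hf (mdiff_inner hY hJZ)]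
  simp only [_root_.add_apply, _root_.smul_apply, smul_eq_mul]
  ring

theorem koszul_tensorial_left (_hY : MDiffAt (T% Y) x) (Z : Π x : M, TangentSpace 𝓘(ℝ, E) x)
    (_hZ : MDiffAt (T% Z) x) :
    TensorialAt 𝓘(ℝ, E) E (fun X : Π x : M, TangentSpace 𝓘(ℝ, E) x ↦ koszul 𝒥 X Y Z x) x where
  smul hf hX := koszul_smul_left hf hX
  add hX hX' := koszul_add_left hX hX'

theorem koszul_tensorial_right (hY : MDiffAt (T% Y) x) (X : Π x : M, TangentSpace 𝓘(ℝ, E) x)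
    (_hX : MDiffAt (T% X) x) :
    TensorialAt 𝓘(ℝ, E) E (fun Z : Π x : M, TangentSpace 𝓘(ℝ, E) x ↦ koszul 𝒥 X Y Z x) x where
  smul hf hZ := koszul_smul_right hf hY hZ
  add hZ hZ' := koszul_add_right hY hZ hZ'

variable (𝒥)

/-- For `Y` differentiable at `x`, the bilinear form `(u, w) ↦ g (∇_u Y) w` on `T_x M`. -/
def koszulForm (hY : MDiffAt (T% Y) x) :
    TangentSpace 𝓘(ℝ, E) x →L[ℝ] TangentSpace 𝓘(ℝ, E) x →L[ℝ] ℝ :=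
  TensorialAt.mkHom₂ (fun X Z ↦ koszul 𝒥 X Y Z x) x
    (koszul_tensorial_left (𝒥 := 𝒥) hY) (koszul_tensorial_right (𝒥 := 𝒥) hY)

theorem koszulForm_apply (hY : MDiffAt (T% Y) x) (hX : MDiffAt (T% X) x)
    (hZ : MDiffAt (T% Z) x) : koszulForm 𝒥 hY (X x) (Z x) = koszul 𝒥 X Y Z x :=
  TensorialAt.mkHom₂_apply _ _ hX hZ

open Classical in
/-- The vector `∇_u Y` at `x`, obtained from `koszulForm` by raising an index (as always for
`CovariantDerivative`, the value at a field `Y` that is not differentiable at `x` is irrelevant). -/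
def canonicalFun (Y : Π x : M, TangentSpace 𝓘(ℝ, E) x) (x : M) :
    TangentSpace 𝓘(ℝ, E) x →L[ℝ] TangentSpace 𝓘(ℝ, E) x :=
  if hY : MDiffAt (T% Y) x then
    LinearMap.toContinuousLinearMap
      { toFun := fun u ↦ (InnerProductSpace.toDual ℝ (TangentSpace 𝓘(ℝ, E) x)).symm
          (koszulForm 𝒥 hY u)
        map_add' := fun u v ↦ by simp
        map_smul' := fun c u ↦ by simp }
  else 0

theorem inner_canonicalFun (hX : MDiffAt (T% X) x) (hY : MDiffAt (T% Y) x)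
    (hZ : MDiffAt (T% Z) x) :
    (inner ℝ (canonicalFun 𝒥 Y x (X x)) (Z x) : ℝ) = koszul 𝒥 X Y Z x := by
  rw [← koszulForm_apply 𝒥 hY hX hZ]
  simp [canonicalFun, hY]

theorem clm_ext {A B : TangentSpace 𝓘(ℝ, E) x →L[ℝ] TangentSpace 𝓘(ℝ, E) x}
    (h : ∀ X Z : Π x : M, TangentSpace 𝓘(ℝ, E) x, MDiffAt (T% X) x → MDiffAt (T% Z) x →
      (inner ℝ (A (X x)) (Z x) : ℝ) = inner ℝ (B (X x)) (Z x)) : A = B := by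
  ext u
  refine ext_inner_right ℝ fun w ↦ ?_
  simpa using h (FiberBundle.extend E u) (FiberBundle.extend E w)
    (mdifferentiableAt_extend ..) (mdifferentiableAt_extend ..)

/-- The canonical connection of an almost Hermitian manifold. It is the unique affine connection
satisfying `IsCanonical`: see `isCanonical_canonicalConnection` and `IsCanonical.eq` below. -/
def canonicalConnection (𝒥 : AlmostHermitianStructure E M) :
    CovariantDerivative 𝓘(ℝ, E) E (fun x : M ↦ TangentSpace 𝓘(ℝ, E) x) where
  toFun := canonicalFun 𝒥.toAlmostComplexStructure
  isCovariantDerivativeOnUniv :=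
    { add := fun {σ σ' x} hσ hσ' _ ↦ clm_ext fun X Z hX hZ ↦ by
        rw [inner_canonicalFun _ hX (mdifferentiableAt_add_section hσ hσ') hZ,
          _root_.add_apply, inner_add_left, inner_canonicalFun _ hX hσ hZ,
          inner_canonicalFun _ hX hσ' hZ, koszul_add_mid hσ hσ' hZ]
      leibniz := fun {σ g x} hσ hg _ ↦ clm_ext fun X Z hX hZ ↦ by
        rw [inner_canonicalFun _ hX (hg.smul_section hσ) hZ,
          _root_.add_apply, inner_add_left, _root_.smul_apply, inner_smul_left,
          inner_canonicalFun _ hX hσ hZ, koszul_smul_mid 𝒥.inner_J_J hg hσ hZ,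
          ContinuousLinearMap.smulRight_apply, inner_smul_left]
        simp }

/-- The defining properties of the canonical connection: `∇ g = 0`, `∇ J = 0`, and the torsion
`τ(X, Y) = ∇_X Y - ∇_Y X - [X, Y]` has vanishing `(1,1)`-part. The `(1,1)`-part of a (vector-valued)
2-form `τ` is `(τ(u, v) + τ(J u, J v)) / 2`, and it vanishes iff the complexification of `τ`
vanishes on `T^{1,0} × T^{0,1}`. (Here `cov Y x u` is `∇_u Y` at `x`.) -/
structure IsCanonical (𝒥 : AlmostHermitianStructure E M)
    (cov : CovariantDerivative 𝓘(ℝ, E) E (fun x : M ↦ TangentSpace 𝓘(ℝ, E) x)) : Prop where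
  metric : ∀ {x : M} {Y Z : Π x : M, TangentSpace 𝓘(ℝ, E) x}, MDiffAt (T% Y) x →
    MDiffAt (T% Z) x → ∀ u : TangentSpace 𝓘(ℝ, E) x,
    mvfderiv 𝓘(ℝ, E) (fun y ↦ (inner ℝ (Y y) (Z y) : ℝ)) x u
      = inner ℝ (cov Y x u) (Z x) + inner ℝ (Y x) (cov Z x u)
  parallel : ∀ {x : M} {Y : Π x : M, TangentSpace 𝓘(ℝ, E) x}, MDiffAt (T% Y) x →
    ∀ u : TangentSpace 𝓘(ℝ, E) x, cov (fun y ↦ 𝒥.J y (Y y)) x u = 𝒥.J x (cov Y x u)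
  torsion : ∀ (x : M) (u v : TangentSpace 𝓘(ℝ, E) x),
    cov.torsion x u v + cov.torsion x (𝒥.J x u) (𝒥.J x v) = 0

theorem exists_field (u : TangentSpace 𝓘(ℝ, E) x) :
    ∃ X : Π x : M, TangentSpace 𝓘(ℝ, E) x, MDiffAt (T% X) x ∧ X x = u :=
  ⟨extend E u, mdifferentiableAt_extend .., by simp⟩

section
variable {𝒥 : AlmostHermitianStructure E M}

theorem inner_app_left (y : M) :
    (inner ℝ (𝒥.app Y y) (Z y) : ℝ) = - inner ℝ (Y y) (𝒥.app Z y) :=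
  inner_J_left 𝒥.inner_J_J _ _

theorem inner_app_app (y : M) :
    (inner ℝ (𝒥.app Y y) (𝒥.app Z y) : ℝ) = inner ℝ (Y y) (Z y) :=
  𝒥.inner_J_J _ _ _

theorem inner_canonicalConnection (hX : MDiffAt (T% X) x) (hY : MDiffAt (T% Y) x)
    (hZ : MDiffAt (T% Z) x) :
    (inner ℝ (canonicalConnection 𝒥 Y x (X x)) (Z x) : ℝ)
      = koszul 𝒥.toAlmostComplexStructure X Y Z x :=
  inner_canonicalFun _ hX hY hZ

theorem canonicalConnection_app (hY : MDiffAt (T% Y) x) (hX : MDiffAt (T% X) x) :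
    canonicalConnection 𝒥 (𝒥.app Y) x (X x) = 𝒥.J x (canonicalConnection 𝒥 Y x (X x)) := by
  have hJY := mdiff_app 𝒥.toAlmostComplexStructure hY
  refine ext_inner_right ℝ fun w ↦ ?_
  obtain ⟨Z, hZ, rfl⟩ := exists_field w
  have hJZ := mdiff_app 𝒥.toAlmostComplexStructure hZ
  rw [inner_J_left 𝒥.inner_J_J, J_app, inner_canonicalConnection hX hJY hZ,
    inner_canonicalConnection hX hY hJZ]
  simp only [koszul, dbar_app_right _ hY, dbar_app_right _ hZ, inner_app_left,
    app_app, inner_J_left 𝒥.inner_J_J, Pi.neg_apply, inner_neg_right, mvfderiv_fun_neg]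
  simp only [J_app, _root_.neg_apply]
  ring

theorem canonicalConnection_add_J (hY : MDiffAt (T% Y) x) (hX : MDiffAt (T% X) x) :
    canonicalConnection 𝒥 Y x (X x) + 𝒥.J x (canonicalConnection 𝒥 Y x (𝒥.app X x))
      = (2 : ℝ) • dbar 𝒥.toAlmostComplexStructure X Y x := by
  have hJX := mdiff_app 𝒥.toAlmostComplexStructure hX
  refine ext_inner_right ℝ fun w ↦ ?_
  obtain ⟨Z, hZ, rfl⟩ := exists_field w
  have hJZ := mdiff_app 𝒥.toAlmostComplexStructure hZ
  rw [inner_add_left, inner_J_left 𝒥.inner_J_J, J_app, inner_canonicalConnection hX hY hZ,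
    inner_canonicalConnection hJX hY hJZ]
  simp only [koszul, dbar_app_left _ hX, dbar_app_right _ hZ, 
    app_app, inner_neg_left, Pi.neg_apply, inner_neg_right, mvfderiv_fun_neg, map_neg, 𝒥.sq,
    inner_smul_left, neg_neg]
  rw [← J_app (𝒥 := 𝒥.toAlmostComplexStructure) (X := Z), 𝒥.inner_J_J]
  simp only [_root_.neg_apply, conj_trivial]
  ring

variable (𝒥) in
/-- The canonical connection has the defining properties. -/
theorem isCanonical_canonicalConnection : IsCanonical 𝒥 (canonicalConnection 𝒥) where
  metric {x Y Z} hY hZ u := by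
    obtain ⟨X, hX, rfl⟩ := exists_field u
    rw [inner_canonicalConnection hX hY hZ, real_inner_comm, inner_canonicalConnection hX hZ hY]
    have e : (fun y ↦ (inner ℝ (Z y) (𝒥.app Y y) : ℝ))
        = fun y ↦ - (inner ℝ (Y y) (𝒥.app Z y) : ℝ) := by
      ext y; rw [real_inner_comm, inner_app_left]
    have e' : (fun y ↦ (inner ℝ (Z y) (Y y) : ℝ)) = fun y ↦ (inner ℝ (Y y) (Z y) : ℝ) := by
      ext y; rw [real_inner_comm]
    simp only [koszul, e, e', mvfderiv_fun_neg]
    rw [real_inner_comm (Z x), real_inner_comm (Y x)]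
    simp only [_root_.neg_apply]
    ring
  parallel {x Y} hY u := by
    obtain ⟨X, hX, rfl⟩ := exists_field u
    exact canonicalConnection_app hY hX
  torsion x u v := by
    obtain ⟨X, hX, rfl⟩ := exists_field u
    obtain ⟨Y, hY, rfl⟩ := exists_field v
    have hJX := mdiff_app 𝒥.toAlmostComplexStructure hX
    have hJY := mdiff_app 𝒥.toAlmostComplexStructure hY
    have h := dbar_sub_swap 𝒥.toAlmostComplexStructure (X := X) (Y := Y) (x := x)
    rw [← canonicalConnection_add_J hY hX, ← canonicalConnection_add_J hX hY] at h
    rw [J_app, J_app, CovariantDerivative.torsion_apply _ hX hY,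
      CovariantDerivative.torsion_apply _ hJX hJY, canonicalConnection_app hY hJX,
      canonicalConnection_app hX hJY]
    refine Eq.trans ?_ (sub_eq_zero.2 h)
    abel

/-- A connection with the defining properties is the canonical connection. -/
theorem IsCanonical.eq {cov : CovariantDerivative 𝓘(ℝ, E) E (fun x : M ↦ TangentSpace 𝓘(ℝ, E) x)}
    (h : IsCanonical 𝒥 cov) (hY : MDiffAt (T% Y) x) :
    cov Y x = canonicalConnection 𝒥 Y x := by
  refine clm_ext fun X Z hX hZ ↦ ?_
  have hJX := mdiff_app 𝒥.toAlmostComplexStructure hX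
  have hJZ := mdiff_app 𝒥.toAlmostComplexStructure hZ
  have key : ∀ {Y : Π x : M, TangentSpace 𝓘(ℝ, E) x}, MDiffAt (T% Y) x →
      dbar 𝒥.toAlmostComplexStructure X Y x
        = (1 / 2 : ℝ) • (cov Y x (X x) + 𝒥.J x (cov Y x (𝒥.app X x))) := by
    intro Y hY
    have hJY := mdiff_app 𝒥.toAlmostComplexStructure hY
    have t1 := h.torsion x (X x) (Y x)
    have t2 := h.torsion x (X x) (𝒥.app Y x)
    have e1 := cov.torsion_apply hX hY
    have e2 := cov.torsion_apply hJX hJY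
    have e3 := cov.torsion_apply hJX hY
    have e4 := cov.torsion_apply hX hJY
    rw [J_app, J_app] at t1
    rw [J_app, J_app, app_app, Pi.neg_apply, map_neg] at t2
    have p1 : ∀ u, cov (𝒥.app Y) x u = 𝒥.J x (cov Y x u) := h.parallel hY
    have p2 : ∀ u, cov (𝒥.app X) x u = 𝒥.J x (cov X x u) := h.parallel hX
    rw [p1, p2] at e2
    rw [p2] at e3
    rw [p1] at e4
    have b1 : mlieBracket 𝓘(ℝ, E) X Y x + mlieBracket 𝓘(ℝ, E) (𝒥.app X) (𝒥.app Y) x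
      = cov Y x (X x) - cov X x (Y x) + (𝒥.J x (cov Y x (𝒥.app X x))
        - 𝒥.J x (cov X x (𝒥.app Y x))) := by
      rw [e1, e2] at t1
      rw [eq_comm, ← sub_eq_zero]
      refine Eq.trans ?_ t1
      abel
    have b2 : mlieBracket 𝓘(ℝ, E) (𝒥.app X) Y x - mlieBracket 𝓘(ℝ, E) X (𝒥.app Y) x
      = cov Y x (𝒥.app X x) - 𝒥.J x (cov X x (Y x)) - (𝒥.J x (cov Y x (X x))
        - cov X x (𝒥.app Y x)) := by
      rw [e3, e4] at t2
      rw [← sub_eq_zero]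
      refine Eq.trans ?_ t2
      abel
    have b3 := congrArg (𝒥.J x) b2
    simp only [map_sub, 𝒥.sq] at b3
    simp only [dbar]
    rw [add_sub_assoc, b1, b3]
    module
  have key' : dbar 𝒥.toAlmostComplexStructure X Y x
        = (1 / 2 : ℝ) • (cov Y x (X x) + 𝒥.J x (cov Y x (𝒥.app X x))) := key hY
  have p : ∀ u, cov (𝒥.app Z) x u = 𝒥.J x (cov Z x u) := h.parallel hZ
  rw [inner_canonicalConnection hX hY hZ]
  simp only [koszul]
  rw [key hY, key hZ, h.metric hY hZ, h.metric hY hJZ, p]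
  simp only [inner_smul_left, inner_smul_right, inner_add_left, inner_add_right, conj_trivial,
    inner_J_left 𝒥.inner_J_J, J_app]
  ring

end

/-- `R(X, Y) Z = ∇_X ∇_Y Z - ∇_Y ∇_X Z - ∇_{[X, Y]} Z` for vector fields `X`, `Y`, `Z`. -/
def curvatureField
    (cov : CovariantDerivative 𝓘(ℝ, E) E (fun x : M ↦ TangentSpace 𝓘(ℝ, E) x))
    (X Y Z : Π x : M, TangentSpace 𝓘(ℝ, E) x) (x : M) : TangentSpace 𝓘(ℝ, E) x :=
  cov (fun y ↦ cov Z y (Y y)) x (X x) - cov (fun y ↦ cov Z y (X y)) x (Y x)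
    - cov Z x (mlieBracket 𝓘(ℝ, E) X Y x)

/-- The curvature tensor `R(u, v) w` at `x` on tangent vectors: `R(X, Y) Z` at `x` for vector fields
`X`, `Y`, `Z` that are smooth near `x` and extend `u`, `v`, `w`. -/
def curvature (cov : CovariantDerivative 𝓘(ℝ, E) E (fun x : M ↦ TangentSpace 𝓘(ℝ, E) x))
    (x : M) (u v w : TangentSpace 𝓘(ℝ, E) x) : TangentSpace 𝓘(ℝ, E) x :=
  curvatureField cov (extend E u) (extend E v) (extend E w) x

/-- The holomorphic sectional curvature of the canonical connection in the direction of the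
`(1,0)`-vector `ξ = v - i J v`, `v ≠ 0`. It is `R(ξ, ξ̄, ξ, ξ̄) / g(ξ, ξ̄) ^ 2` with
`R(X, Y, Z, W) = g(R(Z, W) X, Y)` extended complex-multilinearly. As `R(ξ, ξ̄) = 2 i R(v, J v)`
is skew for `g` and commutes with `J`, the numerator is `4 g(R(v, J v) J v, v)`, and
`g(ξ, ξ̄) = 2 g(v, v)`. -/
def holSecCurv (𝒥 : AlmostHermitianStructure E M) (x : M) (v : TangentSpace 𝓘(ℝ, E) x) : ℝ :=
  inner ℝ (curvature (canonicalConnection 𝒥) x v (𝒥.J x v) (𝒥.J x v)) v / (inner ℝ v v) ^ 2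

end

/-- A smooth map between almost Hermitian manifolds is almost holomorphic if `df ∘ J = J' ∘ df`. -/
def IsAlmostHolomorphic {E : Type*} [NormedAddCommGroup E] [NormedSpace ℝ E]
    {M : Type*} [TopologicalSpace M] [ChartedSpace E M] [IsManifold 𝓘(ℝ, E) ∞ M]
    {F : Type*} [NormedAddCommGroup F] [NormedSpace ℝ F]
    {N : Type*} [TopologicalSpace N] [ChartedSpace F N] [IsManifold 𝓘(ℝ, F) ∞ N]
    (𝒥 : AlmostComplexStructure E M) (𝒥' : AlmostComplexStructure F N) (f : M → N) : Prop :=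
  ContMDiff 𝓘(ℝ, E) 𝓘(ℝ, F) ∞ f ∧ ∀ (x : M) (v : TangentSpace 𝓘(ℝ, E) x),
    mfderiv 𝓘(ℝ, E) 𝓘(ℝ, F) f x (𝒥.J x v) = 𝒥'.J (f x) (mfderiv 𝓘(ℝ, E) 𝓘(ℝ, F) f x v)

end
end AlmostHermitian

/-! The proof is a maximum principle for the stretching of `f`, tested on one well chosen surface.
As `M` is compact, the ratio `|df v|² / |v|²` attains its maximum `lam` at some nonzero `v₀` over a
point `x₀` (`exists_isAttainedStretchBound`). If `lam ≤ 0` there is nothing to prove; otherwise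
curvature has to be compared in the directions `v₀` and `df v₀`.

Take a surface `c(s, t)` through `x₀` with `∂_s c = v₀` at the origin. If `c` were `J`-holomorphic,
then `∂_t c = J ∂_s c`; since `∇J = 0` and `τ(u, J u) = 0` (the vanishing `(1,1)`-part), this gives
`∇_t ∂_s c = J ∇_s ∂_s c`. Commuting derivatives then yields `Δ |∂_s c|² = -2 g(R(∂_s c, J ∂_s c) J
∂_s c, ∂_s c) + 4 |∇_s ∂_s c|²`. At a single point this only needs the holomorphy defect `∂_t c - J
∂_s c` and its `t`-derivative to vanish on the axis `{t = 0}`. Such surfaces are written down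
explicitly as quadratic polynomials in `t` (`exists_isAxisHolomorphic`), with `∇_s ∂_s c = 0`
imposed at the origin. The condition is preserved by almost holomorphic maps, so the same formula
holds for `f ∘ c` (`laplacian_metric`).

The function `|∂_s (f ∘ c)|² - lam |∂_s c|²` is nonpositive and vanishes at the origin, so its
Laplacian there is nonpositive. The remaining gradient term, that of `f ∘ c`, has the favourable
sign and is dropped, leaving `lam · g(R(v₀, J v₀) J v₀, v₀) ≤ g'(R'(w, J' w) J' w, w)` with `w = df
v₀` (`curvature_comparison`). With the curvature bounds this reads `-lam k₁ |v₀|⁴ ≤ -k₂ lam² |v₀|⁴`,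
that is `lam ≤ k₁ / k₂`.

The computation takes place in open subsets of vector spaces, for a metric, an almost complex
structure and Christoffel symbols satisfying `LocalHermitian`. The chart sections show that the
canonical connection and its curvature have this form in coordinates. -/

open Set Filter Topology

set_option synthInstance.maxHeartbeats 200000
set_option linter.unusedSectionVars false

/-! ### Covariant derivatives along maps into an open subset of a vector space. -/

section LocalGeometry

variable {B : Type*} [NormedAddCommGroup B] [NormedSpace ℝ B]
  {E : Type*} [NormedAddCommGroup E] [NormedSpace ℝ E]

/-- The curvature of the connection with Christoffel symbols `Γ` on an open subset of `E`. -/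
noncomputable def localCurvature (Γ : E → E →L[ℝ] E →L[ℝ] E) (p u w z : E) : E :=
  fderiv ℝ Γ p u w z - fderiv ℝ Γ p w u z + Γ p u (Γ p w z) - Γ p w (Γ p u z)

/-- A metric `G`, an orthogonal almost complex structure `J` and the Christoffel symbols `Γ` of a
connection on an open subset `U` of `E` preserving both, with torsion of vanishing
`(1,1)`-part. -/
structure LocalHermitian (U : Set E) (G : E → E →L[ℝ] E →L[ℝ] ℝ) (J : E → E →L[ℝ] E)
    (Γ : E → E →L[ℝ] E →L[ℝ] E) : Prop where
  isOpen : IsOpen U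
  contDiffOn_metric : ContDiffOn ℝ ∞ G U
  contDiffOn_J : ContDiffOn ℝ ∞ J U
  contDiffOn_christoffel : ContDiffOn ℝ ∞ Γ U
  symm : ∀ p ∈ U, ∀ u w, G p u w = G p w u
  pos : ∀ p ∈ U, ∀ u, u ≠ 0 → 0 < G p u u
  J_sq : ∀ p ∈ U, ∀ u, J p (J p u) = -u
  metric_J : ∀ p ∈ U, ∀ u w, G p (J p u) (J p w) = G p u w
  metric : ∀ p ∈ U, ∀ u w z, fderiv ℝ G p u w z = G p (Γ p u w) z + G p w (Γ p u z)
  parallel : ∀ p ∈ U, ∀ u w, fderiv ℝ J p u w + Γ p u (J p w) = J p (Γ p u w)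
  torsion : ∀ p ∈ U, ∀ u w,
    Γ p u w - Γ p w u + (Γ p (J p u) (J p w) - Γ p (J p w) (J p u)) = 0

/-- The covariant derivative in the direction `e` of a field `V` along a map `c`. -/
noncomputable def covDerivAlong (Γ : E → E →L[ℝ] E →L[ℝ] E) (c : B → E) (e : B) (V : B → E) (p : B) :
    E :=
  fderiv ℝ V p e + Γ (c p) (fderiv ℝ c p e) (V p)

theorem covDerivAlong_sub (Γ : E → E →L[ℝ] E →L[ℝ] E) (c : B → E) (e : B) {V W : B → E} {p : B}
    (hV : DifferentiableAt ℝ V p) (hW : DifferentiableAt ℝ W p) :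
    covDerivAlong Γ c e (fun q ↦ V q - W q) p
      = covDerivAlong Γ c e V p - covDerivAlong Γ c e W p := by
  simp only [covDerivAlong, fderiv_fun_sub hV hW, map_sub, _root_.sub_apply]
  abel

theorem covDerivAlong_add (Γ : E → E →L[ℝ] E →L[ℝ] E) (c : B → E) (e : B) {V W : B → E} {p : B}
    (hV : DifferentiableAt ℝ V p) (hW : DifferentiableAt ℝ W p) :
    covDerivAlong Γ c e (fun q ↦ V q + W q) p
      = covDerivAlong Γ c e V p + covDerivAlong Γ c e W p := by
  simp only [covDerivAlong, fderiv_fun_add hV hW, map_add, _root_.add_apply]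
  abel

theorem covDerivAlong_congr (Γ : E → E →L[ℝ] E →L[ℝ] E) (c : B → E) (e : B) {V W : B → E} {p : B}
    (h : V =ᶠ[𝓝 p] W) : covDerivAlong Γ c e V p = covDerivAlong Γ c e W p := by
  simp only [covDerivAlong, h.fderiv_eq, h.eq_of_nhds]

/-- Second derivatives commute. -/
theorem fderiv_fderiv_apply_comm {c : B → E} {p : B} (hc : ContDiffAt ℝ 2 c p) (e f : B) :
    fderiv ℝ (fun q ↦ fderiv ℝ c q e) p f = fderiv ℝ (fun q ↦ fderiv ℝ c q f) p e := by
  have hd : DifferentiableAt ℝ (fderiv ℝ c) p :=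
    (hc.fderiv_right (m := 1) (by norm_num)).differentiableAt (by norm_num)
  have := hc.isSymmSndFDerivAt (by simp) f e
  rw [fderiv_clm_apply hd (differentiableAt_const _), fderiv_clm_apply hd (differentiableAt_const _)]
  simpa using this

theorem ContDiffOn.fderiv_apply_const {c : B → E} {O : Set B} (hO : IsOpen O)
    (hc : ContDiffOn ℝ ∞ c O) (e : B) : ContDiffOn ℝ ∞ (fun p ↦ fderiv ℝ c p e) O :=
  (hc.fderiv_of_isOpen hO (by simp)).clm_apply contDiffOn_const

theorem ContDiffOn.differentiableAt_of_isOpen {c : B → E} {O : Set B} (hO : IsOpen O)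
    (hc : ContDiffOn ℝ ∞ c O) {p : B} (hp : p ∈ O) : DifferentiableAt ℝ c p :=
  (hc.contDiffAt (hO.mem_nhds hp)).differentiableAt (by simp)

theorem ContDiffOn.covDerivAlong {Γ : E → E →L[ℝ] E →L[ℝ] E} {U : Set E} {c V : B → E} {O : Set B}
    (hΓ : ContDiffOn ℝ ∞ Γ U) (hO : IsOpen O) (hc : ContDiffOn ℝ ∞ c O) (hcU : MapsTo c O U)
    (hV : ContDiffOn ℝ ∞ V O) (e : B) : ContDiffOn ℝ ∞ (covDerivAlong Γ c e V) O :=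
  (hV.fderiv_apply_const hO e).add
    (((hΓ.comp hc hcU).clm_apply (hc.fderiv_apply_const hO e)).clm_apply hV)

/-- The commutator of covariant derivatives along a map is the curvature. -/
theorem covDerivAlong_comm {Γ : E → E →L[ℝ] E →L[ℝ] E} {U : Set E} {c V : B → E} {O : Set B}
    (hU : IsOpen U) (hΓ : ContDiffOn ℝ ∞ Γ U) (hO : IsOpen O) (hc : ContDiffOn ℝ ∞ c O)
    (hcU : MapsTo c O U) (hV : ContDiffOn ℝ ∞ V O) {p : B} (hp : p ∈ O) (e f : B) :
    covDerivAlong Γ c e (covDerivAlong Γ c f V) p - covDerivAlong Γ c f (covDerivAlong Γ c e V) p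
      = localCurvature Γ (c p) (fderiv ℝ c p e) (fderiv ℝ c p f) (V p) := by
  have hcp := hc.contDiffAt (hO.mem_nhds hp)
  have dc := hc.differentiableAt_of_isOpen hO hp
  have dV := hV.differentiableAt_of_isOpen hO hp
  have dΓ := hΓ.differentiableAt_of_isOpen hU (hcU hp)
  have dΓc : DifferentiableAt ℝ (fun q ↦ Γ (c q)) p := dΓ.fun_comp' p dc
  have key : ∀ e f : B, covDerivAlong Γ c e (covDerivAlong Γ c f V) p
      = fderiv ℝ (fun q ↦ fderiv ℝ V q f) p e
        + (fderiv ℝ Γ (c p) (fderiv ℝ c p e) (fderiv ℝ c p f) (V p)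
          + Γ (c p) (fderiv ℝ (fun q ↦ fderiv ℝ c q f) p e) (V p)
          + Γ (c p) (fderiv ℝ c p f) (fderiv ℝ V p e))
        + Γ (c p) (fderiv ℝ c p e) (fderiv ℝ V p f + Γ (c p) (fderiv ℝ c p f) (V p)) := by
    intro e f
    have d1 : DifferentiableAt ℝ (fun q ↦ fderiv ℝ V q f) p :=
      (hV.fderiv_apply_const hO f).differentiableAt_of_isOpen hO hp
    have d2 : DifferentiableAt ℝ (fun q ↦ fderiv ℝ c q f) p :=
      (hc.fderiv_apply_const hO f).differentiableAt_of_isOpen hO hp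
    have d3 := dΓc.clm_apply d2
    have e0 : fderiv ℝ (fun q ↦ Γ (c q)) p = (fderiv ℝ Γ (c p)).comp (fderiv ℝ c p) :=
      fderiv_fun_comp p dΓ dc
    have e1 : fderiv ℝ (covDerivAlong Γ c f V) p e = fderiv ℝ (fun q ↦ fderiv ℝ V q f) p e
        + (fderiv ℝ Γ (c p) (fderiv ℝ c p e) (fderiv ℝ c p f) (V p)
          + Γ (c p) (fderiv ℝ (fun q ↦ fderiv ℝ c q f) p e) (V p)
          + Γ (c p) (fderiv ℝ c p f) (fderiv ℝ V p e)) := by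
      unfold covDerivAlong
      rw [fderiv_fun_add d1 (d3.clm_apply dV), fderiv_clm_apply d3 dV, fderiv_clm_apply dΓc d2, e0]
      simp only [_root_.add_apply, ContinuousLinearMap.comp_apply, ContinuousLinearMap.flip_apply]
      abel
    conv_lhs => rw [covDerivAlong, e1, covDerivAlong]
  -- The second derivatives of `V` and of `c`, and the mixed terms `Γ(∂_e c) ∂_f V + Γ(∂_f c) ∂_e
  -- V`, are symmetric in `e, f` and cancel. No bracket term appears because `e` and `f` are
  -- constant.
  rw [key, key, fderiv_fderiv_apply_comm (c := c) (hcp.of_le (ENat.LEInfty.out)) f e,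
    fderiv_fderiv_apply_comm (c := V) ((hV.contDiffAt (hO.mem_nhds hp)).of_le (ENat.LEInfty.out)) f e]
  simp only [localCurvature, map_add]
  abel

/-- A function vanishing on the line `{p.2 = 0}` has vanishing derivative along it. -/
theorem fderiv_apply_eq_zero_of_axis {V : ℝ × ℝ → E} {O : Set (ℝ × ℝ)} (hO : IsOpen O)
    (hV : ∀ p ∈ O, p.2 = 0 → V p = 0) {p : ℝ × ℝ} (hp : p ∈ O) (hp0 : p.2 = 0)
    (hd : DifferentiableAt ℝ V p) : fderiv ℝ V p (1, 0) = 0 := by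
  rw [← hd.lineDeriv_eq_fderiv, lineDeriv]
  have hcont : ContinuousAt (fun t : ℝ ↦ p + t • ((1, 0) : ℝ × ℝ)) 0 := by fun_prop
  have hev : (fun t : ℝ ↦ V (p + t • ((1, 0) : ℝ × ℝ))) =ᶠ[𝓝 0] fun _ ↦ 0 := by
    have : ∀ᶠ t : ℝ in 𝓝 0, p + t • ((1, 0) : ℝ × ℝ) ∈ O :=
      hcont.eventually (hO.mem_nhds (by simpa using hp))
    filter_upwards [this] with t ht
    exact hV _ ht (by simp [hp0])
  rw [hev.deriv_eq]
  simp

namespace LocalHermitian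

variable {U : Set E} {G : E → E →L[ℝ] E →L[ℝ] ℝ} {J : E → E →L[ℝ] E}
  {Γ : E → E →L[ℝ] E →L[ℝ] E}

theorem nonneg (h : LocalHermitian U G J Γ) {p : E} (hp : p ∈ U) (u : E) : 0 ≤ G p u u := by
  rcases eq_or_ne u 0 with rfl | hu
  · simp
  · exact (h.pos p hp u hu).le

variable {c V W : B → E} {p : B}

theorem fderiv_metric_along (h : LocalHermitian U G J Γ) (hcp : c p ∈ U)
    (hc : DifferentiableAt ℝ c p) (hV : DifferentiableAt ℝ V p) (hW : DifferentiableAt ℝ W p)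
    (e : B) :
    fderiv ℝ (fun q ↦ G (c q) (V q) (W q)) p e
      = G (c p) (covDerivAlong Γ c e V p) (W p) + G (c p) (V p) (covDerivAlong Γ c e W p) := by
  have dG := h.contDiffOn_metric.differentiableAt_of_isOpen h.isOpen hcp
  have dGc : DifferentiableAt ℝ (fun q ↦ G (c q)) p := dG.fun_comp' p hc
  have e0 : fderiv ℝ (fun q ↦ G (c q)) p = (fderiv ℝ G (c p)).comp (fderiv ℝ c p) :=
    fderiv_fun_comp p dG hc
  rw [fderiv_clm_apply (dGc.clm_apply hV) hW, fderiv_clm_apply dGc hV, e0]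
  simp only [_root_.add_apply, ContinuousLinearMap.comp_apply, ContinuousLinearMap.flip_apply,
    covDerivAlong, map_add, h.metric _ hcp]
  ring

theorem covDerivAlong_J (h : LocalHermitian U G J Γ) (hcp : c p ∈ U)
    (hc : DifferentiableAt ℝ c p) (hV : DifferentiableAt ℝ V p) (e : B) :
    covDerivAlong Γ c e (fun q ↦ J (c q) (V q)) p = J (c p) (covDerivAlong Γ c e V p) := by
  have dJ := h.contDiffOn_J.differentiableAt_of_isOpen h.isOpen hcp
  have dJc : DifferentiableAt ℝ (fun q ↦ J (c q)) p := dJ.fun_comp' p hc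
  have e0 : fderiv ℝ (fun q ↦ J (c q)) p = (fderiv ℝ J (c p)).comp (fderiv ℝ c p) :=
    fderiv_fun_comp p dJ hc
  rw [covDerivAlong, fderiv_clm_apply dJc hV, e0, covDerivAlong, map_add, ← h.parallel _ hcp]
  simp only [_root_.add_apply, ContinuousLinearMap.comp_apply, ContinuousLinearMap.flip_apply]
  abel

/-- Putting `w = J u` in the torsion condition gives `τ(u, J u) + τ(J u, -u) = 2 τ(u, J u) = 0`.
This is the only way the torsion condition enters the curvature computation. -/
theorem torsion_J (h : LocalHermitian U G J Γ) {p : E} (hp : p ∈ U) (u : E) :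
    Γ p u (J p u) = Γ p (J p u) u := by
  have := h.torsion p hp u (J p u)
  rw [h.J_sq p hp] at this
  simp only [map_neg, _root_.neg_apply] at this
  rw [← sub_eq_zero]
  have h2 : (2 : ℝ) • (Γ p u (J p u) - Γ p (J p u) u) = 0 := by
    rw [← this]; module
  simpa using h2

end LocalHermitian
end LocalGeometry

/-! ### Surfaces holomorphic to first order along an axis, and the Laplacian of `|∂_s c|²`. -/

section LocalGeometry

variable {E : Type*} [NormedAddCommGroup E] [NormedSpace ℝ E]

/-- The failure of a parametrized surface `c` to be `J`-holomorphic. -/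
noncomputable def holDefect (J : E → E →L[ℝ] E) (c : ℝ × ℝ → E) (p : ℝ × ℝ) : E :=
  fderiv ℝ c p (0, 1) - J (c p) (fderiv ℝ c p (1, 0))

/-- A smooth parametrized surface in `U` which is `J`-holomorphic to first order along the axis
`{t = 0}`. -/
structure IsAxisHolomorphic (U : Set E) (J : E → E →L[ℝ] E) (O : Set (ℝ × ℝ)) (c : ℝ × ℝ → E) :
    Prop where
  isOpen : IsOpen O
  contDiffOn : ContDiffOn ℝ ∞ c O
  mapsTo : MapsTo c O U
  defect : ∀ p ∈ O, p.2 = 0 → holDefect J c p = 0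
  fderiv_defect : ∀ p ∈ O, p.2 = 0 → fderiv ℝ (holDefect J c) p (0, 1) = 0

variable {U : Set E} {G : E → E →L[ℝ] E →L[ℝ] ℝ} {J : E → E →L[ℝ] E}
  {Γ : E → E →L[ℝ] E →L[ℝ] E} {O : Set (ℝ × ℝ)} {c : ℝ × ℝ → E} {p : ℝ × ℝ}

theorem IsAxisHolomorphic.contDiffOn_holDefect (hJ : ContDiffOn ℝ ∞ J U)
    (hc : IsAxisHolomorphic U J O c) : ContDiffOn ℝ ∞ (holDefect J c) O :=
  (hc.contDiffOn.fderiv_apply_const hc.isOpen _).sub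
    ((hJ.comp hc.contDiffOn hc.mapsTo).clm_apply
      (hc.contDiffOn.fderiv_apply_const hc.isOpen _))

namespace LocalHermitian

/-- The second derivatives of `c` commute, so the two mixed covariant derivatives differ by the
torsion `τ(∂_s c, ∂_t c)`. -/
theorem covDerivAlong_swap (hc : IsAxisHolomorphic U J O c) (hp : p ∈ O) :
    covDerivAlong Γ c (0, 1) (fun q ↦ fderiv ℝ c q (1, 0)) p
      = covDerivAlong Γ c (1, 0) (fun q ↦ fderiv ℝ c q (0, 1)) p
        - (Γ (c p) (fderiv ℝ c p (1, 0)) (fderiv ℝ c p (0, 1))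
          - Γ (c p) (fderiv ℝ c p (0, 1)) (fderiv ℝ c p (1, 0))) := by
  have := fderiv_fderiv_apply_comm (c := c)
    ((hc.contDiffOn.contDiffAt (hc.isOpen.mem_nhds hp)).of_le ENat.LEInfty.out) (1, 0) (0, 1)
  simp only [covDerivAlong, this]
  abel

/-- `∇_t ∂_s c` in terms of `∇_s ∂_s c` and the defect of holomorphy. -/
theorem covDerivAlong_snd_fst (h : LocalHermitian U G J Γ) (hc : IsAxisHolomorphic U J O c)
    (hp : p ∈ O) :
    covDerivAlong Γ c (0, 1) (fun q ↦ fderiv ℝ c q (1, 0)) p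
      = J (c p) (covDerivAlong Γ c (1, 0) (fun q ↦ fderiv ℝ c q (1, 0)) p)
        + covDerivAlong Γ c (1, 0) (holDefect J c) p
        - (Γ (c p) (fderiv ℝ c p (1, 0)) (holDefect J c p)
          - Γ (c p) (holDefect J c p) (fderiv ℝ c p (1, 0))) := by
  have hcd := hc.contDiffOn
  have hcs := hcd.fderiv_apply_const hc.isOpen (1, 0)
  have hJc : ContDiffOn ℝ ∞ (fun q ↦ J (c q) (fderiv ℝ c q (1, 0))) O :=
    (h.contDiffOn_J.comp hcd hc.mapsTo).clm_apply hcs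
  have hW := hc.contDiffOn_holDefect h.contDiffOn_J
  have e1 : (fun q ↦ fderiv ℝ c q (0, 1))
      = fun q ↦ J (c q) (fderiv ℝ c q (1, 0)) + holDefect J c q := by
    ext q; simp [holDefect]
  have e2 : fderiv ℝ c p (0, 1) = J (c p) (fderiv ℝ c p (1, 0)) + holDefect J c p :=
    congrFun e1 p
  rw [covDerivAlong_swap hc hp, e1, covDerivAlong_add _ _ _
    (hJc.differentiableAt_of_isOpen hc.isOpen hp) (hW.differentiableAt_of_isOpen hc.isOpen hp),
    h.covDerivAlong_J (hc.mapsTo hp) (hcd.differentiableAt_of_isOpen hc.isOpen hp)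
      (hcs.differentiableAt_of_isOpen hc.isOpen hp), e2]
  -- With `∂_t c = J ∂_s c + W`, the part `τ(∂_s c, J ∂_s c)` of the torsion vanishes and only the
  -- term containing the defect `W` survives.
  simp only [map_add, _root_.add_apply, h.torsion_J (hc.mapsTo hp)]
  abel

theorem covDerivAlong_holDefect_axis (h : LocalHermitian U G J Γ)
    (hc : IsAxisHolomorphic U J O c) (hp : p ∈ O) (hp0 : p.2 = 0) :
    covDerivAlong Γ c (1, 0) (holDefect J c) p = 0 := by
  have hW := hc.contDiffOn_holDefect h.contDiffOn_J
  simp [covDerivAlong, hc.defect p hp hp0, fderiv_apply_eq_zero_of_axis hc.isOpen hc.defect hp hp0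
    (hW.differentiableAt_of_isOpen hc.isOpen hp)]

theorem covDerivAlong_snd_fst_axis (h : LocalHermitian U G J Γ) (hc : IsAxisHolomorphic U J O c)
    (hp : p ∈ O) (hp0 : p.2 = 0) :
    covDerivAlong Γ c (0, 1) (fun q ↦ fderiv ℝ c q (1, 0)) p
      = J (c p) (covDerivAlong Γ c (1, 0) (fun q ↦ fderiv ℝ c q (1, 0)) p) := by
  rw [h.covDerivAlong_snd_fst hc hp, h.covDerivAlong_holDefect_axis hc hp hp0,
    hc.defect p hp hp0]
  simp

/-- Since `∇J = 0`, `J` commutes with both covariant derivatives along `c`, hence with their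
commutator. -/
theorem localCurvature_J (h : LocalHermitian U G J Γ) (hc : IsAxisHolomorphic U J O c)
    (hp : p ∈ O) :
    J (c p) (localCurvature Γ (c p) (fderiv ℝ c p (1, 0)) (fderiv ℝ c p (0, 1))
        (fderiv ℝ c p (1, 0)))
      = localCurvature Γ (c p) (fderiv ℝ c p (1, 0)) (fderiv ℝ c p (0, 1))
        (J (c p) (fderiv ℝ c p (1, 0))) := by
  have hcd := hc.contDiffOn
  have hcs := hcd.fderiv_apply_const hc.isOpen (1, 0)
  have hJc : ContDiffOn ℝ ∞ (fun q ↦ J (c q) (fderiv ℝ c q (1, 0))) O :=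
    (h.contDiffOn_J.comp hcd hc.mapsTo).clm_apply hcs
  have hn := fun e ↦ h.contDiffOn_christoffel.covDerivAlong hc.isOpen hcd hc.mapsTo hcs e
  have key : ∀ e f : ℝ × ℝ,
      covDerivAlong Γ c e (covDerivAlong Γ c f fun q ↦ J (c q) (fderiv ℝ c q (1, 0))) p
      = J (c p) (covDerivAlong Γ c e (covDerivAlong Γ c f fun q ↦ fderiv ℝ c q (1, 0)) p) := by
    intro e f
    rw [← h.covDerivAlong_J (hc.mapsTo hp) (hcd.differentiableAt_of_isOpen hc.isOpen hp)
      ((hn f).differentiableAt_of_isOpen hc.isOpen hp)]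
    refine covDerivAlong_congr _ _ _ ?_
    filter_upwards [hc.isOpen.mem_nhds hp] with q hq
    exact h.covDerivAlong_J (hc.mapsTo hq) (hcd.differentiableAt_of_isOpen hc.isOpen hq)
      (hcs.differentiableAt_of_isOpen hc.isOpen hq) f
  rw [← covDerivAlong_comm h.isOpen h.contDiffOn_christoffel hc.isOpen hcd hc.mapsTo hcs hp,
    ← covDerivAlong_comm h.isOpen h.contDiffOn_christoffel hc.isOpen hcd hc.mapsTo hJc hp,
    map_sub, key, key]

/-- `∇_s ∇_s ∂_s c + ∇_t ∇_t ∂_s c = - R(∂_s c, J ∂_s c) J ∂_s c` on the axis. -/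
theorem covDerivAlong_laplacian (h : LocalHermitian U G J Γ) (hc : IsAxisHolomorphic U J O c)
    (hp : p ∈ O) (hp0 : p.2 = 0) :
    covDerivAlong Γ c (1, 0) (covDerivAlong Γ c (1, 0) fun q ↦ fderiv ℝ c q (1, 0)) p
      + covDerivAlong Γ c (0, 1) (covDerivAlong Γ c (0, 1) fun q ↦ fderiv ℝ c q (1, 0)) p
      = - localCurvature Γ (c p) (fderiv ℝ c p (1, 0)) (J (c p) (fderiv ℝ c p (1, 0)))
        (J (c p) (fderiv ℝ c p (1, 0))) := by
  have hcd := hc.contDiffOn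
  have hO := hc.isOpen
  have hcU := hc.mapsTo
  have hcs := hcd.fderiv_apply_const hO (1, 0)
  have hW := hc.contDiffOn_holDefect h.contDiffOn_J
  have hΓ := h.contDiffOn_christoffel
  have hns := hΓ.covDerivAlong hO hcd hcU hcs (1, 0)
  have hnt := hΓ.covDerivAlong hO hcd hcU hcs (0, 1)
  have hWs := hΓ.covDerivAlong hO hcd hcU hW (1, 0)
  have hWt := hΓ.covDerivAlong hO hcd hcU hW (0, 1)
  have hΓc : ContDiffOn ℝ ∞ (fun q ↦ Γ (c q)) O := hΓ.comp hcd hcU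
  have hτ : ContDiffOn ℝ ∞ (fun q ↦ Γ (c q) (fderiv ℝ c q (1, 0)) (holDefect J c q)
          - Γ (c q) (holDefect J c q) (fderiv ℝ c q (1, 0))) O :=
    ((hΓc.clm_apply hcs).clm_apply hW).sub ((hΓc.clm_apply hW).clm_apply hcs)
  have hJn : ContDiffOn ℝ ∞ (fun q ↦ J (c q)
      (covDerivAlong Γ c (1, 0) (fun q ↦ fderiv ℝ c q (1, 0)) q)) O :=
    (h.contDiffOn_J.comp hcd hcU).clm_apply hns
  have D : ∀ {V : ℝ × ℝ → E}, ContDiffOn ℝ ∞ V O → DifferentiableAt ℝ V p :=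
    fun hV ↦ hV.differentiableAt_of_isOpen hO hp
  have hW0 := hc.defect p hp hp0
  have e1 : covDerivAlong Γ c (0, 1) (covDerivAlong Γ c (0, 1) fun q ↦ fderiv ℝ c q (1, 0)) p
      = covDerivAlong Γ c (0, 1) (fun q ↦
        J (c q) (covDerivAlong Γ c (1, 0) (fun q ↦ fderiv ℝ c q (1, 0)) q)
        + covDerivAlong Γ c (1, 0) (holDefect J c) q
        - (Γ (c q) (fderiv ℝ c q (1, 0)) (holDefect J c q)
          - Γ (c q) (holDefect J c q) (fderiv ℝ c q (1, 0)))) p := by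
    refine covDerivAlong_congr _ _ _ ?_
    filter_upwards [hO.mem_nhds hp] with q hq
    exact h.covDerivAlong_snd_fst hc hq
  -- The torsion term is linear in the defect, which vanishes at `p` together with its
  -- `t`-derivative.
  have e2 : covDerivAlong Γ c (0, 1) (fun q ↦ Γ (c q) (fderiv ℝ c q (1, 0)) (holDefect J c q)
          - Γ (c q) (holDefect J c q) (fderiv ℝ c q (1, 0))) p = 0 := by
    have d0 : DifferentiableAt ℝ (fun q ↦ Γ (c q)) p :=
      hΓc.differentiableAt_of_isOpen hO hp
    have d1 := D hcs
    have d2 := D hW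
    rw [covDerivAlong, fderiv_fun_sub ((d0.clm_apply d1).clm_apply d2)
      ((d0.clm_apply d2).clm_apply d1), fderiv_clm_apply (d0.clm_apply d1) d2,
      fderiv_clm_apply (d0.clm_apply d2) d1, fderiv_clm_apply d0 d2]
    simp [hW0, hc.fderiv_defect p hp hp0]
  -- Interchange the derivatives: the curvature term is linear in the defect and so vanishes, and
  -- `∇_t` of the defect is zero all along the axis, so its `s`-derivative vanishes too.
  have e3 : covDerivAlong Γ c (0, 1) (covDerivAlong Γ c (1, 0) (holDefect J c)) p = 0 := by
    have hz : ∀ q ∈ O, q.2 = 0 → covDerivAlong Γ c (0, 1) (holDefect J c) q = 0 := by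
      intro q hq hq0
      simp [covDerivAlong, hc.defect q hq hq0, hc.fderiv_defect q hq hq0]
    have hcomm := covDerivAlong_comm h.isOpen hΓ hO hcd hcU hW hp (0, 1) (1, 0)
    have hz1 : covDerivAlong Γ c (1, 0) (covDerivAlong Γ c (0, 1) (holDefect J c)) p = 0 := by
      rw [covDerivAlong, fderiv_apply_eq_zero_of_axis hO hz hp hp0 (D hWt), hz p hp hp0]
      simp
    rw [hz1, sub_zero, hW0] at hcomm
    rw [hcomm]
    simp [localCurvature]
  -- The relation `∇_t ∂_s c = J ∇_s ∂_s c` holds along the whole axis, and so may be differentiated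
  -- in the direction `s`.
  have e4 : covDerivAlong Γ c (1, 0) (covDerivAlong Γ c (0, 1) fun q ↦ fderiv ℝ c q (1, 0)) p
      = J (c p) (covDerivAlong Γ c (1, 0)
        (covDerivAlong Γ c (1, 0) fun q ↦ fderiv ℝ c q (1, 0)) p) := by
    rw [← h.covDerivAlong_J (hcU hp) (D hcd) (D hns), ← sub_eq_zero,
      ← covDerivAlong_sub _ _ _ (D hnt) (D hJn), covDerivAlong,
      fderiv_apply_eq_zero_of_axis hO _ hp hp0 ((D hnt).fun_sub (D hJn)),
      h.covDerivAlong_snd_fst_axis hc hp hp0]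
    · simp
    · intro q hq hq0
      exact sub_eq_zero.2 (h.covDerivAlong_snd_fst_axis hc hq hq0)
  have e5 : fderiv ℝ c p (0, 1) = J (c p) (fderiv ℝ c p (1, 0)) := sub_eq_zero.1 hW0
  -- Now `∇_t ∇_t ∂_s c = J ∇_t ∇_s ∂_s c = J (J ∇_s ∇_s ∂_s c - R(∂_s c, ∂_t c) ∂_s c)`; `J² = -1`
  -- produces the cancelling term, and `J` moves inside the curvature.
  have hcomm := covDerivAlong_comm h.isOpen hΓ hO hcd hcU hcs hp (1, 0) (0, 1)
  rw [e4, sub_eq_iff_eq_add, ← sub_eq_iff_eq_add'] at hcomm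
  rw [e1, covDerivAlong_sub _ _ _ ((D hJn).fun_add (D hWs)) (D hτ), e2,
    covDerivAlong_add _ _ _ (D hJn) (D hWs), e3, h.covDerivAlong_J (hcU hp) (D hcd) (D hns),
    ← hcomm, map_sub, h.J_sq _ (hcU hp), h.localCurvature_J hc hp, e5]
  abel

/-- The Laplacian of the square norm of `∂_s c` at a point of the axis. -/
theorem laplacian_metric (h : LocalHermitian U G J Γ) (hc : IsAxisHolomorphic U J O c)
    (hp : p ∈ O) (hp0 : p.2 = 0) :
    fderiv ℝ (fun q ↦ fderiv ℝ (fun r ↦ G (c r) (fderiv ℝ c r (1, 0)) (fderiv ℝ c r (1, 0))) q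
        (1, 0)) p (1, 0)
      + fderiv ℝ (fun q ↦ fderiv ℝ (fun r ↦ G (c r) (fderiv ℝ c r (1, 0)) (fderiv ℝ c r (1, 0))) q
        (0, 1)) p (0, 1)
      = -2 * G (c p) (localCurvature Γ (c p) (fderiv ℝ c p (1, 0))
          (J (c p) (fderiv ℝ c p (1, 0))) (J (c p) (fderiv ℝ c p (1, 0)))) (fderiv ℝ c p (1, 0))
        + 4 * G (c p) (covDerivAlong Γ c (1, 0) (fun q ↦ fderiv ℝ c q (1, 0)) p)
            (covDerivAlong Γ c (1, 0) (fun q ↦ fderiv ℝ c q (1, 0)) p) := by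
  have hcd := hc.contDiffOn
  have hO := hc.isOpen
  have hcU := hc.mapsTo
  have hcs := hcd.fderiv_apply_const hO (1, 0)
  have hn := fun e ↦ h.contDiffOn_christoffel.covDerivAlong hO hcd hcU hcs e
  have hG : ContDiffOn ℝ ∞ (fun q ↦ G (c q)) O := h.contDiffOn_metric.comp hcd hcU
  have D : ∀ {q : ℝ × ℝ} {V : ℝ × ℝ → E}, q ∈ O → ContDiffOn ℝ ∞ V O → DifferentiableAt ℝ V q :=
    fun hq hV ↦ hV.differentiableAt_of_isOpen hO hq
  have key : ∀ e : ℝ × ℝ,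
      fderiv ℝ (fun q ↦ fderiv ℝ (fun r ↦ G (c r) (fderiv ℝ c r (1, 0)) (fderiv ℝ c r (1, 0))) q
        e) p e
      = 2 * G (c p) (covDerivAlong Γ c e (covDerivAlong Γ c e fun q ↦ fderiv ℝ c q (1, 0)) p)
          (fderiv ℝ c p (1, 0))
        + 2 * G (c p) (covDerivAlong Γ c e (fun q ↦ fderiv ℝ c q (1, 0)) p)
          (covDerivAlong Γ c e (fun q ↦ fderiv ℝ c q (1, 0)) p) := by
    intro e
    have e1 : (fun q ↦ fderiv ℝ (fun r ↦ G (c r) (fderiv ℝ c r (1, 0)) (fderiv ℝ c r (1, 0))) q e)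
        =ᶠ[𝓝 p] fun q ↦ 2 * G (c q) (covDerivAlong Γ c e (fun q ↦ fderiv ℝ c q (1, 0)) q)
          (fderiv ℝ c q (1, 0)) := by
      filter_upwards [hO.mem_nhds hp] with q hq
      rw [h.fderiv_metric_along (hcU hq) (D hq hcd) (D hq hcs) (D hq hcs),
        h.symm _ (hcU hq) (fderiv ℝ c q (1, 0))]
      ring
    have hd : DifferentiableAt ℝ (fun q ↦ G (c q)
        (covDerivAlong Γ c e (fun q ↦ fderiv ℝ c q (1, 0)) q) (fderiv ℝ c q (1, 0))) p :=
      ((hG.clm_apply (hn e)).clm_apply hcs).differentiableAt_of_isOpen hO hp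
    rw [e1.fderiv_eq, fderiv_const_mul hd, _root_.smul_apply,
      h.fderiv_metric_along (hcU hp) (D hp hcd) (D hp (hn e)) (D hp hcs), smul_eq_mul]
    ring
  have hl := h.covDerivAlong_laplacian hc hp hp0
  -- `|∇_t ∂_s c| = |J ∇_s ∂_s c| = |∇_s ∂_s c|`, so the two gradient terms add up to the
  -- coefficient `4`.
  rw [key, key, h.covDerivAlong_snd_fst_axis hc hp hp0, h.metric_J _ (hcU hp)]
  rw [← eq_sub_iff_add_eq'] at hl
  rw [hl]
  simp only [map_sub, map_neg, _root_.sub_apply, _root_.neg_apply]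
  ring

end LocalHermitian
end LocalGeometry

/-! ### Construction of the test surfaces and the maximum principle in coordinates. -/

section LocalGeometry

variable {E : Type*} [NormedAddCommGroup E] [NormedSpace ℝ E]
  {F : Type*} [NormedAddCommGroup F] [NormedSpace ℝ F]

/-- Holomorphy to first order along the axis is preserved by pseudo-holomorphic maps. -/
theorem IsAxisHolomorphic.comp {V : Set E} {J : E → E →L[ℝ] E} {U' : Set F} {J' : F → F →L[ℝ] F}
    {O : Set (ℝ × ℝ)} {c : ℝ × ℝ → E} (hc : IsAxisHolomorphic V J O c) (hV : IsOpen V)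
    (hJ : ContDiffOn ℝ ∞ J V) {f : E → F} (hf : ContDiffOn ℝ ∞ f V) (hfU : MapsTo f V U')
    (hol : ∀ p ∈ V, ∀ u, fderiv ℝ f p (J p u) = J' (f p) (fderiv ℝ f p u)) :
    IsAxisHolomorphic U' J' O (fun q ↦ f (c q)) := by
  have hd : ∀ q ∈ O, fderiv ℝ (fun q ↦ f (c q)) q = (fderiv ℝ f (c q)).comp (fderiv ℝ c q) :=
    fun q hq ↦ fderiv_fun_comp q (hf.differentiableAt_of_isOpen hV (hc.mapsTo hq))
      (hc.contDiffOn.differentiableAt_of_isOpen hc.isOpen hq)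
  -- As `df` intertwines `J` and `J'`, it carries the defect of `c` to that of `f ∘ c`. In the
  -- product rule for the `t`-derivative each term then contains the defect of `c` or its
  -- derivative.
  have key : ∀ q ∈ O, holDefect J' (fun q ↦ f (c q)) q = fderiv ℝ f (c q) (holDefect J c q) := by
    intro q hq
    simp [holDefect, hd q hq, hol _ (hc.mapsTo hq)]
  refine ⟨hc.isOpen, hf.comp hc.contDiffOn hc.mapsTo, hfU.comp hc.mapsTo, ?_, ?_⟩
  · intro q hq hq0
    rw [key q hq, hc.defect q hq hq0, map_zero]
  · intro q hq hq0
    have hev : holDefect J' (fun q ↦ f (c q)) =ᶠ[𝓝 q]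
        fun q ↦ fderiv ℝ f (c q) (holDefect J c q) := by
      filter_upwards [hc.isOpen.mem_nhds hq] with r hr using key r hr
    have d1 : DifferentiableAt ℝ (fun q ↦ fderiv ℝ f (c q)) q :=
      ((hf.fderiv_of_isOpen hV (m := ∞) (by simp)).comp hc.contDiffOn
        hc.mapsTo).differentiableAt_of_isOpen hc.isOpen hq
    have d2 := (hc.contDiffOn_holDefect hJ).differentiableAt_of_isOpen hc.isOpen hq
    rw [hev.fderiv_eq, fderiv_clm_apply d1 d2]
    simp [hc.defect q hq hq0, hc.fderiv_defect q hq hq0]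

/-- Existence of surfaces that are pseudo-holomorphic to first order along the axis, with
prescribed first and second derivatives along the axis at the origin. -/
theorem exists_isAxisHolomorphic {U : Set E} (hU : IsOpen U) {J : E → E →L[ℝ] E}
    (hJ : ContDiffOn ℝ ∞ J U) {p₀ : E} (hp₀ : p₀ ∈ U) (v d : E) :
    ∃ (O : Set (ℝ × ℝ)) (c : ℝ × ℝ → E), IsAxisHolomorphic U J O c ∧ (0, 0) ∈ O ∧ c (0, 0) = p₀ ∧
      fderiv ℝ c (0, 0) (1, 0) = v ∧ fderiv ℝ (fun q ↦ fderiv ℝ c q (1, 0)) (0, 0) (1, 0) = d := by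
  -- The surface is `c₀ + t c₁ + (t² / 2) c₂`, with coefficients depending on `s`. The axis curve
  -- `c₀` carries the prescribed derivatives `v`, `d` at the origin, and `b₀` is its velocity.
  set c₀ : ℝ → E := fun s ↦ p₀ + s • v + (s ^ 2 / 2) • d with hc₀
  set b₀ : ℝ → E := fun s ↦ v + s • d with hb₀
  have hc₀s : ContDiff ℝ ∞ c₀ := by fun_prop
  have hb₀s : ContDiff ℝ ∞ b₀ := by fun_prop
  have hdc₀ : ∀ s, HasDerivAt c₀ (b₀ s) s := by
    intro s
    have h1 : HasDerivAt (fun s : ℝ ↦ s ^ 2 / 2) s s := by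
      simpa using (hasDerivAt_pow 2 s).div_const 2
    have := (((hasDerivAt_id s).smul_const v).const_add p₀).fun_add (h1.smul_const d)
    simpa [hb₀] using this
  set I : Set ℝ := c₀ ⁻¹' U
  have hI : IsOpen I := hU.preimage hc₀s.continuous
  -- This choice of `∂_t c` on the axis makes the defect vanish there.
  set c₁ : ℝ → E := fun s ↦ J (c₀ s) (b₀ s) with hc₁
  have hJc : ContDiffOn ℝ ∞ (fun s ↦ J (c₀ s)) I := hJ.comp hc₀s.contDiffOn fun _ h ↦ h
  have hc₁s : ContDiffOn ℝ ∞ c₁ I := hJc.clm_apply hb₀s.contDiffOn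
  -- This is `∂_t (J(c) ∂_s c)` at `t = 0`, so the `t`-derivative of the defect vanishes on the axis
  -- as well.
  set c₂ : ℝ → E := fun s ↦ fderiv ℝ J (c₀ s) (c₁ s) (b₀ s) + J (c₀ s) (fderiv ℝ c₁ s 1) with hc₂
  have hc₂s : ContDiffOn ℝ ∞ c₂ I :=
    (((((hJ.fderiv_of_isOpen hU (m := ∞) (by simp)).comp hc₀s.contDiffOn
      fun _ h ↦ h).clm_apply hc₁s).clm_apply hb₀s.contDiffOn)).add
      (hJc.clm_apply (hc₁s.fderiv_apply_const hI 1))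
  have hdc : ∀ {b : ℝ → E}, ContDiffOn ℝ ∞ b I → ∀ s ∈ I, HasDerivAt b (fderiv ℝ b s 1) s :=
    fun hb s hs ↦ by
      simpa using (hb.differentiableAt_of_isOpen hI hs).hasDerivAt
  set c : ℝ × ℝ → E := fun q ↦ c₀ q.1 + q.2 • c₁ q.1 + (q.2 ^ 2 / 2) • c₂ q.1 with hc
  set Ω : Set (ℝ × ℝ) := Prod.fst ⁻¹' I
  have hΩ : IsOpen Ω := hI.preimage continuous_fst
  have hcΩ : ContDiffOn ℝ ∞ c Ω := by
    have h1 : ContDiffOn ℝ ∞ (fun q : ℝ × ℝ ↦ c₁ q.1) Ω := hc₁s.comp contDiffOn_fst fun _ h ↦ h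
    have h2 : ContDiffOn ℝ ∞ (fun q : ℝ × ℝ ↦ c₂ q.1) Ω := hc₂s.comp contDiffOn_fst fun _ h ↦ h
    have h0 : ContDiffOn ℝ ∞ (fun q : ℝ × ℝ ↦ c₀ q.1) Ω := by fun_prop
    exact (h0.add (contDiffOn_snd.smul h1)).add
      (((contDiffOn_snd.pow 2).div_const 2).smul h2)
  set O : Set (ℝ × ℝ) := Ω ∩ c ⁻¹' U
  have hO : IsOpen O := hcΩ.continuousOn.isOpen_inter_preimage hΩ hU
  have hcO : ContDiffOn ℝ ∞ c O := hcΩ.mono inter_subset_left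
  have hs : ∀ q ∈ O, fderiv ℝ c q (1, 0)
      = b₀ q.1 + q.2 • fderiv ℝ c₁ q.1 1 + (q.2 ^ 2 / 2) • fderiv ℝ c₂ q.1 1 := by
    intro q hq
    rw [← (hcO.differentiableAt_of_isOpen hO hq).lineDeriv_eq_fderiv]
    have ha : ∀ {b : ℝ → E} {b' : E}, HasDerivAt b b' q.1 →
        HasDerivAt (fun t : ℝ ↦ b (q.1 + t)) b' 0 := fun hb ↦
      HasDerivAt.comp_const_add q.1 0 (by simpa using hb)
    have := (((ha (hdc₀ q.1)).fun_add ((ha (hdc hc₁s q.1 hq.1)).fun_const_smul q.2)).fun_add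
      ((ha (hdc hc₂s q.1 hq.1)).fun_const_smul (q.2 ^ 2 / 2))).deriv
    simp only [lineDeriv, hc]
    simpa using this
  have ht : ∀ q ∈ O, fderiv ℝ c q (0, 1) = c₁ q.1 + q.2 • c₂ q.1 := by
    intro q hq
    rw [← (hcO.differentiableAt_of_isOpen hO hq).lineDeriv_eq_fderiv]
    have h0 : HasDerivAt (fun t : ℝ ↦ q.2 + t) 1 0 := by
      simpa using (hasDerivAt_id (0 : ℝ)).const_add q.2
    have h1 := h0.smul_const (c₁ q.1)
    have h2 := ((h0.pow 2).div_const 2).smul_const (c₂ q.1)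
    have := ((h1.const_add (c₀ q.1)).fun_add h2).deriv
    simp only [lineDeriv, hc]
    simpa using this
  have hdef : ∀ q ∈ O, holDefect J c q = c₁ q.1 + q.2 • c₂ q.1
      - J (c q) (b₀ q.1 + q.2 • fderiv ℝ c₁ q.1 1 + (q.2 ^ 2 / 2) • fderiv ℝ c₂ q.1 1) :=
    fun q hq ↦ by rw [holDefect, hs q hq, ht q hq]
  have hpre : IsAxisHolomorphic U J O c := by
    refine ⟨hO, hcO, fun q hq ↦ hq.2, ?_, ?_⟩
    · intro q hq hq0
      rw [hdef q hq]
      simp [hq0, hc, hc₁]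
    · intro q hq hq0
      have hdd : DifferentiableAt ℝ (holDefect J c) q :=
        ((hcO.fderiv_apply_const hO _).sub
          ((hJ.comp hcO fun q hq ↦ hq.2).clm_apply
            (hcO.fderiv_apply_const hO _))).differentiableAt_of_isOpen hO hq
      rw [← hdd.lineDeriv_eq_fderiv, lineDeriv]
      have hcont : ContinuousAt (fun t : ℝ ↦ q + t • ((0, 1) : ℝ × ℝ)) 0 := by fun_prop
      have hev : (fun t : ℝ ↦ holDefect J c (q + t • ((0, 1) : ℝ × ℝ))) =ᶠ[𝓝 0] fun t ↦
          c₁ q.1 + t • c₂ q.1 - J (c (q.1, t))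
            (b₀ q.1 + t • fderiv ℝ c₁ q.1 1 + (t ^ 2 / 2) • fderiv ℝ c₂ q.1 1) := by
        filter_upwards [hcont.eventually (hO.mem_nhds (by simpa using hq))] with t ht'
        have e : q + t • ((0, 1) : ℝ × ℝ) = (q.1, t) := by ext <;> simp [hq0]
        rw [hdef _ ht', e]
      rw [hev.deriv_eq]
      have hsq : HasDerivAt (fun t : ℝ ↦ t ^ 2 / 2) 0 0 := by
        simpa using (hasDerivAt_pow 2 (0 : ℝ)).div_const 2
      have hid := hasDerivAt_id (0 : ℝ)
      have h1 := (hid.smul_const (c₂ q.1)).const_add (c₁ q.1)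
      have h2 := (((hid.smul_const (fderiv ℝ c₁ q.1 1)).const_add (b₀ q.1)).add
        (hsq.smul_const (fderiv ℝ c₂ q.1 1)))
      have h3 : HasDerivAt (fun t : ℝ ↦ c (q.1, t)) (c₁ q.1) 0 := by
        have := ((hid.smul_const (c₁ q.1)).const_add (c₀ q.1)).fun_add (hsq.smul_const (c₂ q.1))
        simpa [hc] using this
      have ec : c (q.1, 0) = c₀ q.1 := by simp [hc]
      have h4 : HasDerivAt (fun t : ℝ ↦ J (c (q.1, t))) (fderiv ℝ J (c₀ q.1) (c₁ q.1)) 0 := by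
        have hJd : HasFDerivAt J (fderiv ℝ J (c₀ q.1)) (c (q.1, 0)) := by
          rw [ec]
          exact (hJ.differentiableAt_of_isOpen hU hq.1).hasFDerivAt
        exact hJd.comp_hasDerivAt (0 : ℝ) h3
      have h5 := (h1.sub (h4.clm_apply h2)).deriv
      refine Eq.trans ?_ (h5.trans ?_)
      · rfl
      · simp [hc₂, ec]
  have h0O : ((0, 0) : ℝ × ℝ) ∈ O := by
    refine ⟨?_, ?_⟩
    · change c₀ 0 ∈ U
      simpa [hc₀] using hp₀
    · change c (0, 0) ∈ U
      simpa [hc, hc₀] using hp₀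
  refine ⟨O, c, hpre, h0O, by simp [hc, hc₀], by simp [hs _ h0O, hb₀], ?_⟩
  have hdd := (hcO.fderiv_apply_const hO (1, 0)).differentiableAt_of_isOpen hO h0O
  rw [← hdd.lineDeriv_eq_fderiv, lineDeriv]
  have hcont : ContinuousAt (fun t : ℝ ↦ ((0, 0) : ℝ × ℝ) + t • ((1, 0) : ℝ × ℝ)) 0 := by fun_prop
  have hev : (fun t : ℝ ↦ fderiv ℝ c (((0, 0) : ℝ × ℝ) + t • ((1, 0) : ℝ × ℝ)) (1, 0))
      =ᶠ[𝓝 0] fun t ↦ v + t • d := by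
    filter_upwards [hcont.eventually (hO.mem_nhds (by simpa using h0O))] with t ht'
    rw [hs _ ht']
    simp [hb₀]
  rw [hev.deriv_eq]
  simpa using (((hasDerivAt_id (0 : ℝ)).smul_const d).const_add v).deriv

/-- The second derivative at a local maximum is nonpositive. -/
theorem IsLocalMax.deriv_deriv_nonpos {f : ℝ → ℝ} {x : ℝ} (h : IsLocalMax f x)
    (hf : ContinuousAt f x) : deriv (deriv f) x ≤ 0 := by
  -- A positive second derivative would make `x` a local minimum too, so `f` would be constant near
  -- `x` and its second derivative zero.
  by_contra! hpos
  have hmin := isLocalMin_of_deriv_deriv_pos hpos h.deriv_eq_zero hf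
  have hev : f =ᶠ[𝓝 x] fun _ ↦ f x := by
    filter_upwards [h, hmin] with y h1 h2 using le_antisymm h1 h2
  have : deriv (deriv f) x = 0 := by
    rw [hev.deriv.deriv_eq]
    simp
  linarith

theorem IsLocalMax.fderiv_fderiv_nonpos {f : E → ℝ} {x : E} (h : IsLocalMax f x)
    (hf : ContDiffAt ℝ 2 f x) (e : E) : fderiv ℝ (fun y ↦ fderiv ℝ f y e) x e ≤ 0 := by
  have hcont : ContinuousAt (fun t : ℝ ↦ x + t • e) 0 := by fun_prop
  have hcont' : Tendsto (fun t : ℝ ↦ x + t • e) (𝓝 0) (𝓝 x) := by simpa [ContinuousAt] using hcont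
  have hm : IsLocalMax (fun t : ℝ ↦ f (x + t • e)) 0 := by
    filter_upwards [hcont'.eventually h] with t ht
    simpa using ht
  have hd : deriv (fun t : ℝ ↦ f (x + t • e)) =ᶠ[𝓝 0] fun t ↦ fderiv ℝ f (x + t • e) e := by
    have : ∀ᶠ y in 𝓝 x, DifferentiableAt ℝ f y :=
      (hf.eventually (by simp)).mono fun y hy ↦ hy.differentiableAt (by simp)
    filter_upwards [hcont'.eventually this] with t ht
    have hl : HasDerivAt (fun t : ℝ ↦ x + t • e) e t := by
      simpa using ((hasDerivAt_id t).smul_const e).const_add x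
    exact (ht.hasFDerivAt.comp_hasDerivAt t hl).deriv
  have h2 := hm.deriv_deriv_nonpos (by
    refine ContinuousAt.comp (g := f) ?_ hcont
    simpa using hf.continuousAt)
  rw [hd.deriv_eq] at h2
  have hdd : DifferentiableAt ℝ (fun y ↦ fderiv ℝ f y e) x :=
    (((hf.fderiv_right (m := 1) (by norm_num)).differentiableAt (by norm_num)).clm_apply
      (differentiableAt_const e))
  rwa [← hdd.lineDeriv_eq_fderiv]

/-- The maximum principle: a pseudo-holomorphic map `f` that stretches no vector by more than `lam`,
and some vector `v` exactly by `lam`, compares the curvatures in the direction of `v`. -/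
theorem LocalHermitian.curvature_comparison {U V : Set E} {G : E → E →L[ℝ] E →L[ℝ] ℝ}
    {J : E → E →L[ℝ] E} {Γ : E → E →L[ℝ] E →L[ℝ] E} {U' : Set F} {G' : F → F →L[ℝ] F →L[ℝ] ℝ}
    {J' : F → F →L[ℝ] F} {Γ' : F → F →L[ℝ] F →L[ℝ] F}
    (h : LocalHermitian U G J Γ) (h' : LocalHermitian U' G' J' Γ') (hV : IsOpen V) (hVU : V ⊆ U)
    {f : E → F} (hf : ContDiffOn ℝ ∞ f V) (hfU : MapsTo f V U')
    (hol : ∀ p ∈ V, ∀ u, fderiv ℝ f p (J p u) = J' (f p) (fderiv ℝ f p u)) {lam : ℝ}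
    (hlam : ∀ p ∈ V, ∀ u, G' (f p) (fderiv ℝ f p u) (fderiv ℝ f p u) ≤ lam * G p u u)
    {p₀ : E} (hp₀ : p₀ ∈ V) {v : E}
    (heq : G' (f p₀) (fderiv ℝ f p₀ v) (fderiv ℝ f p₀ v) = lam * G p₀ v v) :
    lam * G p₀ (localCurvature Γ p₀ v (J p₀ v) (J p₀ v)) v
      ≤ G' (f p₀) (localCurvature Γ' (f p₀) (fderiv ℝ f p₀ v) (J' (f p₀) (fderiv ℝ f p₀ v))
          (J' (f p₀) (fderiv ℝ f p₀ v))) (fderiv ℝ f p₀ v) := by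
  have hJV := h.contDiffOn_J.mono hVU
  -- The second derivative `-Γ(v, v)` makes `∇_s ∂_s c` vanish at the origin. This removes the
  -- gradient term of the source, whose sign is unfavourable when `lam > 0`.
  obtain ⟨O, c, hc, h0, hc0, hcs, hcss⟩ := exists_isAxisHolomorphic hV hJV hp₀ v (-(Γ p₀ v v))
  have hc' := hc.comp hV hJV hf hfU hol
  have hcU : IsAxisHolomorphic U J O c := ⟨hc.isOpen, hc.contDiffOn, hc.mapsTo.mono_right hVU,
    hc.defect, hc.fderiv_defect⟩
  have hO := hc.isOpen
  have l := h.laplacian_metric hcU h0 rfl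
  have l' := h'.laplacian_metric hc' h0 rfl
  have hn : covDerivAlong Γ c (1, 0) (fun q ↦ fderiv ℝ c q (1, 0)) (0, 0) = 0 := by
    simp [covDerivAlong, hcss, hcs, hc0]
  have hd : ∀ q ∈ O, fderiv ℝ (fun q ↦ f (c q)) q (1, 0)
      = fderiv ℝ f (c q) (fderiv ℝ c q (1, 0)) := by
    intro q hq
    rw [fderiv_fun_comp q (hf.differentiableAt_of_isOpen hV (hc.mapsTo hq))
      (hc.contDiffOn.differentiableAt_of_isOpen hO hq), ContinuousLinearMap.comp_apply]
  have n' := h'.nonneg (hc'.mapsTo h0)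
    (covDerivAlong Γ' (fun q ↦ f (c q)) (1, 0) (fun q ↦ fderiv ℝ (fun q ↦ f (c q)) q (1, 0)) (0, 0))
  rw [hn] at l
  simp only [hd _ h0] at l'
  simp only [hc0, hcs, map_zero, mul_zero, add_zero] at l l' n'
  set φ : ℝ × ℝ → ℝ := fun r ↦ G (c r) (fderiv ℝ c r (1, 0)) (fderiv ℝ c r (1, 0)) with hφ
  set φ' : ℝ × ℝ → ℝ := fun r ↦ G' (f (c r)) (fderiv ℝ (fun q ↦ f (c q)) r (1, 0))
    (fderiv ℝ (fun q ↦ f (c q)) r (1, 0)) with hφ'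
  have sφ : ContDiffOn ℝ ∞ φ O :=
    ((h.contDiffOn_metric.comp hcU.contDiffOn hcU.mapsTo).clm_apply
      (hc.contDiffOn.fderiv_apply_const hO _)).clm_apply (hc.contDiffOn.fderiv_apply_const hO _)
  have sφ' : ContDiffOn ℝ ∞ φ' O :=
    ((h'.contDiffOn_metric.comp hc'.contDiffOn hc'.mapsTo).clm_apply
      (hc'.contDiffOn.fderiv_apply_const hO _)).clm_apply (hc'.contDiffOn.fderiv_apply_const hO _)
  -- `hlam` makes the difference nonpositive on all of `O`, and `heq` makes it zero at the origin.
  have hmax : IsLocalMax (fun r ↦ φ' r - lam * φ r) (0, 0) := by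
    filter_upwards [hO.mem_nhds h0] with q hq
    have e0 : φ' (0, 0) - lam * φ (0, 0) = 0 := by
      simp only [hφ, hφ', hd _ h0]
      rw [hc0, hcs, heq, sub_self]
    rw [e0, sub_nonpos]
    simp only [hφ, hφ', hd _ hq]
    exact hlam _ (hc.mapsTo hq) _
  have hsm : ContDiffOn ℝ ∞ (fun r ↦ φ' r - lam * φ r) O := sφ'.sub (contDiffOn_const.mul sφ)
  have key : ∀ e : ℝ × ℝ, fderiv ℝ (fun q ↦ fderiv ℝ φ' q e) (0, 0) e
      - lam * fderiv ℝ (fun q ↦ fderiv ℝ φ q e) (0, 0) e ≤ 0 := by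
    intro e
    have h1 := hmax.fderiv_fderiv_nonpos
      ((hsm.contDiffAt (hO.mem_nhds h0)).of_le ENat.LEInfty.out) e
    have h2 : (fun q ↦ fderiv ℝ (fun r ↦ φ' r - lam * φ r) q e) =ᶠ[𝓝 (0, 0)]
        fun q ↦ fderiv ℝ φ' q e - lam * fderiv ℝ φ q e := by
      filter_upwards [hO.mem_nhds h0] with q hq
      have d := sφ.differentiableAt_of_isOpen hO hq
      rw [fderiv_fun_sub (sφ'.differentiableAt_of_isOpen hO hq) (d.const_mul lam),
        fderiv_const_mul d]
      simp
    have d := (sφ.fderiv_apply_const hO e).differentiableAt_of_isOpen hO h0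
    have d' := (sφ'.fderiv_apply_const hO e).differentiableAt_of_isOpen hO h0
    rw [h2.fderiv_eq, fderiv_fun_sub d' (d.const_mul lam), fderiv_const_mul d] at h1
    simpa using h1
  have k1 := key (1, 0)
  have k2 := key (0, 1)
  -- With the Laplacian formula for `φ` multiplied by `lam`, the rest is linear: add `k1` and `k2`,
  -- then drop the nonnegative gradient term `n'`.
  have k3 : lam * (fderiv ℝ (fun q ↦ fderiv ℝ φ q (1, 0)) (0, 0) (1, 0)
    + fderiv ℝ (fun q ↦ fderiv ℝ φ q (0, 1)) (0, 0) (0, 1)) =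
    lam * (-2 * G p₀ (localCurvature Γ p₀ v (J p₀ v) (J p₀ v)) v) := by rw [l]
  linarith

end LocalGeometry

/-! ### Tangent vectors, vector fields and Lie brackets in a chart. -/

section ChartFields

variable {E : Type*} [NormedAddCommGroup E] [NormedSpace ℝ E]
  {M : Type*} [TopologicalSpace M] [ChartedSpace E M] [IsManifold 𝓘(ℝ, E) ∞ M]

/-- The coordinates of tangent vectors in the chart at `x₀`. -/
noncomputable def tangentCoord (x₀ y : M) : TangentSpace 𝓘(ℝ, E) y →L[ℝ] E :=
  mfderiv 𝓘(ℝ, E) 𝓘(ℝ, E) (extChartAt 𝓘(ℝ, E) x₀) y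

/-- The vector field on `M` which is given by `A` in the chart at `x₀`. -/
noncomputable def chartField (x₀ : M) (A : E → E) (y : M) : TangentSpace 𝓘(ℝ, E) y :=
  (tangentCoord x₀ y).inverse (A (extChartAt 𝓘(ℝ, E) x₀ y))

variable {x₀ y : M}

theorem isInvertible_tangentCoord (hy : y ∈ (chartAt E x₀).source) :
    (tangentCoord (E := E) x₀ y).IsInvertible :=
  isInvertible_mfderiv_extChartAt (by simpa using hy)

theorem tangentCoord_inverse (hy : y ∈ (chartAt E x₀).source) (u : E) :
    tangentCoord x₀ y ((tangentCoord x₀ y).inverse u) = u :=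
  (isInvertible_tangentCoord hy).self_apply_inverse u

theorem inverse_tangentCoord (hy : y ∈ (chartAt E x₀).source) (u : TangentSpace 𝓘(ℝ, E) y) :
    (tangentCoord x₀ y).inverse (tangentCoord x₀ y u) = u :=
  (isInvertible_tangentCoord hy).inverse_apply_self u

theorem tangentCoord_chartField (hy : y ∈ (chartAt E x₀).source) (A : E → E) :
    tangentCoord x₀ y (chartField x₀ A y) = A (extChartAt 𝓘(ℝ, E) x₀ y) :=
  tangentCoord_inverse hy _

theorem tangentCoord_injective (hy : y ∈ (chartAt E x₀).source) :
    Function.Injective (tangentCoord (E := E) x₀ y) :=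
  Function.LeftInverse.injective (inverse_tangentCoord hy)

theorem trivializationAt_snd (hy : y ∈ (chartAt E x₀).source) (u : TangentSpace 𝓘(ℝ, E) y) :
    (trivializationAt E (TangentSpace 𝓘(ℝ, E)) x₀ ⟨y, u⟩).2 = tangentCoord x₀ y u := by
  rw [tangentCoord, ← TangentBundle.continuousLinearMapAt_trivializationAt hy]
  exact (Trivialization.continuousLinearMapAt_apply_of_mem ℝ
    (trivializationAt E (TangentSpace 𝓘(ℝ, E)) x₀) (by simpa using hy) u).symm

theorem contMDiffAt_chartField {A : E → E} {n : ℕ∞} (hy : y ∈ (chartAt E x₀).source)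
    (hA : ContDiffAt ℝ n A (extChartAt 𝓘(ℝ, E) x₀ y)) :
    ContMDiffAt 𝓘(ℝ, E) (𝓘(ℝ, E).prod 𝓘(ℝ, E)) n
      (fun y ↦ TotalSpace.mk' E y (chartField x₀ A y)) y := by
  rw [(trivializationAt E (TangentSpace 𝓘(ℝ, E)) x₀).contMDiffAt_section_iff (by simpa using hy)]
  have h1 : ContMDiffAt 𝓘(ℝ, E) 𝓘(ℝ, E) n (fun y ↦ A (extChartAt 𝓘(ℝ, E) x₀ y)) y :=
    hA.contMDiffAt.comp y ((contMDiffAt_extChartAt' hy).of_le (n := ∞) (by exact_mod_cast le_top))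
  refine h1.congr_of_eventuallyEq ?_
  filter_upwards [(chartAt E x₀).open_source.mem_nhds hy] with z hz
  rw [trivializationAt_snd hz, tangentCoord_chartField hz]

theorem mdifferentiableAt_chartField {A : E → E} (hy : y ∈ (chartAt E x₀).source)
    (hA : DifferentiableAt ℝ A (extChartAt 𝓘(ℝ, E) x₀ y)) :
    MDiffAt (T% (chartField x₀ A)) y := by
  rw [(trivializationAt E (TangentSpace 𝓘(ℝ, E)) x₀).mdifferentiableAt_section_iff _ _
    (by simpa using hy)]
  have h1 : MDiffAt (fun y ↦ A (extChartAt 𝓘(ℝ, E) x₀ y)) y :=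
    hA.mdifferentiableAt.comp y (mdifferentiableAt_extChartAt hy)
  refine h1.congr_of_eventuallyEq ?_
  filter_upwards [(chartAt E x₀).open_source.mem_nhds hy] with z hz
  rw [trivializationAt_snd hz, tangentCoord_chartField hz]

theorem chartField_congr {A B : E → E} (h : A (extChartAt 𝓘(ℝ, E) x₀ y) = B (extChartAt 𝓘(ℝ, E) x₀ y)) :
    chartField x₀ A y = chartField x₀ B y := by
  rw [chartField, h, chartField]

/-- `extend` keeps the component in the trivialization at `x` constant, and that trivialization is
the derivative of the chart. So the fields used in `curvature` have constant coordinates and commute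
near `x`. -/
theorem extend_eq_chartField (x : M) (u : TangentSpace 𝓘(ℝ, E) x) (hy : y ∈ (chartAt E x).source) :
    extend E u y = chartField x (fun _ ↦ tangentCoord x x u) y := by
  apply tangentCoord_injective hy
  rw [tangentCoord_chartField hy, ← trivializationAt_snd hy,
    ← trivializationAt_snd (mem_chart_source E x), extend,
    Trivialization.apply_mk_symm _ (by simpa using hy)]

theorem mvfderiv_comp_extChartAt {F : Type*} [NormedAddCommGroup F] [NormedSpace ℝ F] {h : E → F}
    (hy : y ∈ (chartAt E x₀).source) (hh : DifferentiableAt ℝ h (extChartAt 𝓘(ℝ, E) x₀ y))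
    (u : TangentSpace 𝓘(ℝ, E) y) :
    mvfderiv 𝓘(ℝ, E) (fun z ↦ h (extChartAt 𝓘(ℝ, E) x₀ z)) y u
      = fderiv ℝ h (extChartAt 𝓘(ℝ, E) x₀ y) (tangentCoord x₀ y u) := by
  have h1 : HasMFDerivAt 𝓘(ℝ, E) 𝓘(ℝ, F) h (extChartAt 𝓘(ℝ, E) x₀ y)
    (fderiv ℝ h (extChartAt 𝓘(ℝ, E) x₀ y)) := hh.hasFDerivAt.hasMFDerivAt
  have h2 := (mdifferentiableAt_extChartAt (I := 𝓘(ℝ, E)) hy).hasMFDerivAt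
  have h3 := (h1.comp y h2).mfderiv
  exact congrArg (fun L ↦ L u) h3

theorem mdifferentiableAt_vectorSpace {A : Π p : E, TangentSpace 𝓘(ℝ, E) p} {p : E}
    (hA : DifferentiableAt ℝ (fun q ↦ (A q : E)) p) :
    MDifferentiableAt 𝓘(ℝ, E) (𝓘(ℝ, E).prod 𝓘(ℝ, E))
      (fun q : E ↦ TotalSpace.mk' E q (A q)) p := by
  rw [(trivializationAt E (TangentSpace 𝓘(ℝ, E)) p).mdifferentiableAt_section_iff _ _ (by simp)]
  simpa using! hA.mdifferentiableAt

theorem mlieBracket_vectorSpace (V W : Π p : E, TangentSpace 𝓘(ℝ, E) p) :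
    mlieBracket 𝓘(ℝ, E) V W = lieBracket ℝ V W := by
  rw [← mlieBracketWithin_univ, mlieBracketWithin_eq_lieBracketWithin]
  exact lieBracketWithin_univ

/-- `chartField` is the pullback of a field on `E` under the chart, and the Lie bracket is natural
under pullback. -/
theorem mlieBracket_chartField [CompleteSpace E] {A B : E → E} (hy : y ∈ (chartAt E x₀).source)
    (hA : DifferentiableAt ℝ A (extChartAt 𝓘(ℝ, E) x₀ y))
    (hB : DifferentiableAt ℝ B (extChartAt 𝓘(ℝ, E) x₀ y)) :
    tangentCoord x₀ y (mlieBracket 𝓘(ℝ, E) (chartField x₀ A) (chartField x₀ B) y)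
      = fderiv ℝ B (extChartAt 𝓘(ℝ, E) x₀ y) (A (extChartAt 𝓘(ℝ, E) x₀ y))
        - fderiv ℝ A (extChartAt 𝓘(ℝ, E) x₀ y) (B (extChartAt 𝓘(ℝ, E) x₀ y)) := by
  have : IsManifold 𝓘(ℝ, E) (minSmoothness ℝ 2) M := by
    rw [minSmoothness_of_isRCLikeNormedField]; infer_instance
  have h := mpullback_mlieBracket (I := 𝓘(ℝ, E)) (I' := 𝓘(ℝ, E)) (n := ∞)
    (f := extChartAt 𝓘(ℝ, E) x₀)
    (V := A) (W := B) (x₀ := y) (mdifferentiableAt_vectorSpace hA) (mdifferentiableAt_vectorSpace hB)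
    (contMDiffAt_extChartAt' hy)
    (by rw [minSmoothness_of_isRCLikeNormedField]; exact ENat.LEInfty.out)
  exact (congrArg (tangentCoord x₀ y) h.symm).trans ((tangentCoord_inverse (E := E) hy _).trans
    (congrFun (mlieBracket_vectorSpace (E := E) A B) _))

end ChartFields

/-! ### An explicit formula for the Christoffel symbols, and their smoothness. -/

section LocalGeometry

variable {E : Type*} [NormedAddCommGroup E] [NormedSpace ℝ E]

/-- The zeroth order part of the operator `dbar` of the almost complex structure `J`. -/
noncomputable def dbarForm (J : E → E →L[ℝ] E) (p u w : E) : E :=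
  (1 / 4 : ℝ) • (fderiv ℝ J p (J p u) w - fderiv ℝ J p (J p w) u - J p (fderiv ℝ J p w u)
    - J p (fderiv ℝ J p u w))

/-- The Christoffel symbols (of the first kind) of the canonical connection of `(G, J)`. -/
noncomputable def christoffelForm (G : E → E →L[ℝ] E →L[ℝ] ℝ) (J : E → E →L[ℝ] E)
    (p u w z : E) : ℝ :=
  (1 / 2 : ℝ) * (fderiv ℝ G p u w z + fderiv ℝ G p (J p u) w (J p z)
    + G p w (fderiv ℝ J p (J p u) z)) + G p (dbarForm J p u w) z - G p w (dbarForm J p u z)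

section
variable (G : E → E →L[ℝ] E →L[ℝ] ℝ) (J : E → E →L[ℝ] E) (p u u' w w' z z' : E) (a : ℝ)

theorem dbarForm_add_left : dbarForm J p (u + u') w = dbarForm J p u w + dbarForm J p u' w := by
  simp only [dbarForm, map_add, _root_.add_apply]
  module

theorem dbarForm_smul_left : dbarForm J p (a • u) w = a • dbarForm J p u w := by
  simp only [dbarForm, map_smul, _root_.smul_apply]
  module

theorem dbarForm_add_right : dbarForm J p u (w + w') = dbarForm J p u w + dbarForm J p u w' := by
  simp only [dbarForm, map_add, _root_.add_apply]
  module

theorem dbarForm_smul_right : dbarForm J p u (a • w) = a • dbarForm J p u w := by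
  simp only [dbarForm, map_smul, _root_.smul_apply]
  module

theorem christoffelForm_add_left :
    christoffelForm G J p (u + u') w z = christoffelForm G J p u w z + christoffelForm G J p u' w z := by
  simp only [christoffelForm, dbarForm_add_left, map_add, _root_.add_apply]
  ring

theorem christoffelForm_smul_left :
    christoffelForm G J p (a • u) w z = a * christoffelForm G J p u w z := by
  simp only [christoffelForm, dbarForm_smul_left, map_smul, _root_.smul_apply, smul_eq_mul]
  ring

theorem christoffelForm_add_mid :
    christoffelForm G J p u (w + w') z = christoffelForm G J p u w z + christoffelForm G J p u w' z := by
  simp only [christoffelForm, dbarForm_add_right, map_add, _root_.add_apply]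
  ring

theorem christoffelForm_smul_mid :
    christoffelForm G J p u (a • w) z = a * christoffelForm G J p u w z := by
  simp only [christoffelForm, dbarForm_smul_right, map_smul, _root_.smul_apply, smul_eq_mul]
  ring

theorem christoffelForm_add_right :
    christoffelForm G J p u w (z + z') = christoffelForm G J p u w z + christoffelForm G J p u w z' := by
  simp only [christoffelForm, dbarForm_add_right, map_add]
  ring

theorem christoffelForm_smul_right :
    christoffelForm G J p u w (a • z) = a * christoffelForm G J p u w z := by
  simp only [christoffelForm, dbarForm_smul_right, map_smul, smul_eq_mul]
  ring

end

variable [FiniteDimensional ℝ E]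

/-- `christoffelForm` as a covector in its last argument. -/
noncomputable def christoffelCovector (G : E → E →L[ℝ] E →L[ℝ] ℝ) (J : E → E →L[ℝ] E)
    (p u w : E) : E →L[ℝ] ℝ :=
  LinearMap.toContinuousLinearMap
    { toFun := christoffelForm G J p u w
      map_add' := christoffelForm_add_right G J p u w
      map_smul' := fun a z ↦ christoffelForm_smul_right G J p u w z a }

theorem christoffelCovector_apply (G : E → E →L[ℝ] E →L[ℝ] ℝ) (J : E → E →L[ℝ] E) (p u w z : E) :
    christoffelCovector G J p u w z = christoffelForm G J p u w z := rfl

/-- The Christoffel symbols of the canonical connection of `(G, J)`. -/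
noncomputable def christoffel (G : E → E →L[ℝ] E →L[ℝ] ℝ) (J : E → E →L[ℝ] E) (p : E) :
    E →L[ℝ] E →L[ℝ] E :=
  LinearMap.toContinuousBilinearMap (LinearMap.mk₂ ℝ
    (fun u w ↦ (G p).inverse (christoffelCovector G J p u w))
    (fun u u' w ↦ by
      rw [← map_add]; congr 1; ext z; exact christoffelForm_add_left ..)
    (fun a u w ↦ by
      rw [← map_smul]; congr 1; ext z; exact christoffelForm_smul_left ..)
    (fun u w w' ↦ by
      rw [← map_add]; congr 1; ext z; exact christoffelForm_add_mid ..)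
    (fun a u w ↦ by
      rw [← map_smul]; congr 1; ext z; exact christoffelForm_smul_mid ..))

variable {G : E → E →L[ℝ] E →L[ℝ] ℝ} {J : E → E →L[ℝ] E} {U : Set E} {p : E}

/-- Positivity gives injectivity, and a finite-dimensional space has the same dimension as its dual.
This allows raising an index with `G p`. -/
theorem isInvertible_of_pos {L : E →L[ℝ] E →L[ℝ] ℝ} (h : ∀ u, u ≠ 0 → 0 < L u u) :
    L.IsInvertible := by
  have hinj : Function.Injective L := by
    rw [injective_iff_map_eq_zero]
    intro u hu
    by_contra hne
    have := h u hne
    simp [hu] at this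
  have hfin : Module.finrank ℝ E = Module.finrank ℝ (E →L[ℝ] ℝ) := by
    rw [← (LinearMap.toContinuousLinearMap (𝕜 := ℝ) (E := E) (F' := ℝ)).finrank_eq]
    exact (Subspace.dual_finrank_eq (K := ℝ) (V := E)).symm
  exact ⟨(LinearEquiv.ofInjectiveOfFinrankEq L.toLinearMap hinj hfin).toContinuousLinearEquiv,
    by ext; rfl⟩

theorem metric_christoffel (h : (G p).IsInvertible) (u w z : E) :
    G p (christoffel G J p u w) z = christoffelForm G J p u w z := by
  simp only [christoffel, LinearMap.toContinuousBilinearMap_apply, LinearMap.mk₂_apply]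
  rw [h.self_apply_inverse, christoffelCovector_apply]

/-- `christoffelForm` is built from `G`, `J` and their first derivatives by evaluation, sums and
products, and inversion of `G p` is smooth. Evaluating at constant vectors reduces the claim to
these facts. -/
theorem contDiffOn_christoffel (hU : IsOpen U) (hG : ContDiffOn ℝ ∞ G U) (hJ : ContDiffOn ℝ ∞ J U)
    (h : ∀ p ∈ U, (G p).IsInvertible) : ContDiffOn ℝ ∞ (christoffel G J) U := by
  have hG' := hG.fderiv_of_isOpen hU (m := ∞) (by simp)
  have hJ' := hJ.fderiv_of_isOpen hU (m := ∞) (by simp)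
  rw [contDiffOn_clm_apply]
  intro u
  rw [contDiffOn_clm_apply]
  intro w
  have hinv : ContDiffOn ℝ ∞ (fun p ↦ (G p).inverse) U := fun p hp ↦
    ((h p hp).contDiffAt_map_inverse).comp_contDiffWithinAt p (hG p hp)
  have hB : ∀ {a b : E → E}, ContDiffOn ℝ ∞ a U → ContDiffOn ℝ ∞ b U →
      ContDiffOn ℝ ∞ (fun p ↦ dbarForm J p (a p) (b p)) U := by
    intro a b ha hb
    exact contDiffOn_const.smul (((((hJ'.clm_apply (hJ.clm_apply ha)).clm_apply hb).sub
      ((hJ'.clm_apply (hJ.clm_apply hb)).clm_apply ha)).sub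
      (hJ.clm_apply ((hJ'.clm_apply hb).clm_apply ha))).sub
      (hJ.clm_apply ((hJ'.clm_apply ha).clm_apply hb)))
  have hform : ContDiffOn ℝ ∞ (fun p ↦ G p (christoffel G J p u w)) U := by
    rw [contDiffOn_clm_apply]
    intro z
    have hu : ContDiffOn ℝ ∞ (fun _ : E ↦ u) U := contDiffOn_const
    have hw : ContDiffOn ℝ ∞ (fun _ : E ↦ w) U := contDiffOn_const
    have hz : ContDiffOn ℝ ∞ (fun _ : E ↦ z) U := contDiffOn_const
    have : ContDiffOn ℝ ∞ (fun p ↦ christoffelForm G J p u w z) U :=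
      ((contDiffOn_const.mul (((((hG'.clm_apply hu).clm_apply hw).clm_apply hz).add
        (((hG'.clm_apply (hJ.clm_apply hu)).clm_apply hw).clm_apply (hJ.clm_apply hz))).add
        ((hG.clm_apply hw).clm_apply ((hJ'.clm_apply (hJ.clm_apply hu)).clm_apply hz)))).add
        ((hG.clm_apply (hB hu hw)).clm_apply hz)).sub ((hG.clm_apply hw).clm_apply (hB hu hz))
    exact this.congr fun p hp ↦ metric_christoffel (h p hp) u w z
  refine (hinv.clm_apply hform).congr fun p hp ↦ ?_
  rw [(h p hp).inverse_apply_self]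

end LocalGeometry

/-! ### The metric, the almost complex structure and `dbar` in a chart. -/

namespace AlmostHermitian

section
variable {E : Type*} [NormedAddCommGroup E] [NormedSpace ℝ E] [FiniteDimensional ℝ E]
  {M : Type*} [TopologicalSpace M] [ChartedSpace E M] [IsManifold 𝓘(ℝ, E) ∞ M]
  [RiemannianBundle (fun x : M ↦ TangentSpace 𝓘(ℝ, E) x)]
  [IsContMDiffRiemannianBundle 𝓘(ℝ, E) ∞ E (fun x : M ↦ TangentSpace 𝓘(ℝ, E) x)]

/-- The metric in the chart at `x₀`. -/
noncomputable def chartMetric (x₀ : M) (p : E) : E →L[ℝ] E →L[ℝ] ℝ :=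
  (innerSL ℝ (E := TangentSpace 𝓘(ℝ, E) ((extChartAt 𝓘(ℝ, E) x₀).symm p))).bilinearComp
    (tangentCoord x₀ _).inverse (tangentCoord x₀ _).inverse

/-- The almost complex structure in the chart at `x₀`. -/
noncomputable def chartJ (𝒥 : AlmostComplexStructure E M) (x₀ : M) (p : E) : E →L[ℝ] E :=
  (tangentCoord x₀ _).comp
    ((𝒥.J ((extChartAt 𝓘(ℝ, E) x₀).symm p)).comp (tangentCoord x₀ _).inverse)

variable {x₀ y : M}

theorem chartMetric_tangentCoord (hy : y ∈ (chartAt E x₀).source) (u w : TangentSpace 𝓘(ℝ, E) y) :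
    chartMetric x₀ (extChartAt 𝓘(ℝ, E) x₀ y) (tangentCoord x₀ y u) (tangentCoord x₀ y w)
      = inner ℝ u w := by
  have e : (extChartAt 𝓘(ℝ, E) x₀).symm (extChartAt 𝓘(ℝ, E) x₀ y) = y :=
    (extChartAt 𝓘(ℝ, E) x₀).left_inv (by simpa using hy)
  simp only [chartMetric, ContinuousLinearMap.bilinearComp_apply]
  rw [e]
  rw [inverse_tangentCoord hy, inverse_tangentCoord hy]
  rfl

theorem chartJ_tangentCoord (𝒥 : AlmostComplexStructure E M) (hy : y ∈ (chartAt E x₀).source)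
    (u : TangentSpace 𝓘(ℝ, E) y) :
    chartJ 𝒥 x₀ (extChartAt 𝓘(ℝ, E) x₀ y) (tangentCoord x₀ y u) = tangentCoord x₀ y (𝒥.J y u) := by
  have e : (extChartAt 𝓘(ℝ, E) x₀).symm (extChartAt 𝓘(ℝ, E) x₀ y) = y :=
    (extChartAt 𝓘(ℝ, E) x₀).left_inv (by simpa using hy)
  simp only [chartJ, ContinuousLinearMap.comp_apply]
  rw [e, inverse_tangentCoord hy]

theorem inner_chartField (hy : y ∈ (chartAt E x₀).source) (A B : E → E) :
    (inner ℝ (chartField x₀ A y) (chartField x₀ B y) : ℝ)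
      = chartMetric x₀ (extChartAt 𝓘(ℝ, E) x₀ y) (A (extChartAt 𝓘(ℝ, E) x₀ y))
        (B (extChartAt 𝓘(ℝ, E) x₀ y)) := by
  rw [← chartMetric_tangentCoord hy, tangentCoord_chartField hy, tangentCoord_chartField hy]

theorem app_chartField (𝒥 : AlmostComplexStructure E M) (hy : y ∈ (chartAt E x₀).source)
    (A : E → E) :
    𝒥.app (chartField x₀ A) y = chartField x₀ (fun p ↦ chartJ 𝒥 x₀ p (A p)) y := by
  apply tangentCoord_injective hy
  rw [tangentCoord_chartField hy, ← tangentCoord_chartField hy A, chartJ_tangentCoord 𝒥 hy]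
  rfl

theorem app_chartField_eventuallyEq (𝒥 : AlmostComplexStructure E M)
    (hy : y ∈ (chartAt E x₀).source) (A : E → E) :
    𝒥.app (chartField x₀ A) =ᶠ[𝓝 y] chartField x₀ (fun p ↦ chartJ 𝒥 x₀ p (A p)) := by
  filter_upwards [(chartAt E x₀).open_source.mem_nhds hy] with z hz using app_chartField 𝒥 hz A

theorem exists_chart_eq {p : E} (hp : p ∈ (extChartAt 𝓘(ℝ, E) x₀).target) :
    ∃ y : M, y ∈ (chartAt E x₀).source ∧ extChartAt 𝓘(ℝ, E) x₀ y = p ∧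
      (extChartAt 𝓘(ℝ, E) x₀).symm p = y :=
  ⟨(extChartAt 𝓘(ℝ, E) x₀).symm p, by simpa using (extChartAt 𝓘(ℝ, E) x₀).map_target hp,
    (extChartAt 𝓘(ℝ, E) x₀).right_inv hp, rfl⟩

theorem contDiffOn_of_comp_extChartAt {F : Type*} [NormedAddCommGroup F] [NormedSpace ℝ F]
    {h : E → F} (hh : ∀ y ∈ (chartAt E x₀).source,
      ContMDiffAt 𝓘(ℝ, E) 𝓘(ℝ, F) ∞ (fun z ↦ h (extChartAt 𝓘(ℝ, E) x₀ z)) y) :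
    ContDiffOn ℝ ∞ h (extChartAt 𝓘(ℝ, E) x₀).target := by
  intro p hp
  obtain ⟨y, hy, rfl, hy'⟩ := exists_chart_eq hp
  have h1 : ContMDiffWithinAt 𝓘(ℝ, E) 𝓘(ℝ, E) ∞ (extChartAt 𝓘(ℝ, E) x₀).symm
      (extChartAt 𝓘(ℝ, E) x₀).target (extChartAt 𝓘(ℝ, E) x₀ y) :=
    contMDiffOn_extChartAt_symm x₀ _ hp
  have h2 := hh y hy
  rw [← hy'] at h2
  have h3 := h2.comp_contMDiffWithinAt _ h1
  rw [contMDiffWithinAt_iff_contDiffWithinAt] at h3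
  exact h3.congr (fun q hq ↦ congrArg h ((extChartAt 𝓘(ℝ, E) x₀).right_inv hq).symm)
    (congrArg h ((extChartAt 𝓘(ℝ, E) x₀).right_inv hp).symm)

/-- The coefficients are inner products of the smooth fields with constant coordinates `u` and `w`.
-/
theorem contDiffOn_chartMetric (x₀ : M) :
    ContDiffOn ℝ ∞ (chartMetric x₀) (extChartAt 𝓘(ℝ, E) x₀).target := by
  rw [contDiffOn_clm_apply]
  intro u
  rw [contDiffOn_clm_apply]
  intro w
  refine contDiffOn_of_comp_extChartAt fun y hy ↦ ?_
  have h : ContMDiffAt 𝓘(ℝ, E) 𝓘(ℝ, ℝ) ∞ (fun z ↦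
      (inner ℝ (chartField x₀ (fun _ ↦ u) z) (chartField x₀ (fun _ ↦ w) z) : ℝ)) y :=
    ContMDiffAt.inner_bundle (IB := 𝓘(ℝ, E)) (F := E)
      (E := fun x : M ↦ TangentSpace 𝓘(ℝ, E) x) (b := fun x ↦ x)
      (contMDiffAt_chartField (n := ⊤) hy contDiffAt_const)
      (contMDiffAt_chartField (n := ⊤) hy contDiffAt_const)
  refine h.congr_of_eventuallyEq ?_
  filter_upwards [(chartAt E x₀).open_source.mem_nhds hy] with z hz
  rw [inner_chartField hz]

theorem contDiffOn_chartJ (𝒥 : AlmostComplexStructure E M) (x₀ : M) :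
    ContDiffOn ℝ ∞ (chartJ 𝒥 x₀) (extChartAt 𝓘(ℝ, E) x₀).target := by
  rw [contDiffOn_clm_apply]
  intro u
  refine contDiffOn_of_comp_extChartAt fun y hy ↦ ?_
  have h : ContMDiffAt 𝓘(ℝ, E) (𝓘(ℝ, E).prod 𝓘(ℝ, E)) ∞
      (fun z ↦ TotalSpace.mk' E z (𝒥.app (chartField x₀ (fun _ ↦ u)) z)) y :=
    ContMDiffAt.clm_bundle_apply (𝒥.contMDiff y)
      (contMDiffAt_chartField (n := ⊤) hy contDiffAt_const)
  rw [(trivializationAt E (TangentSpace 𝓘(ℝ, E)) x₀).contMDiffAt_section_iff (by simpa using hy)] at h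
  refine h.congr_of_eventuallyEq ?_
  filter_upwards [(chartAt E x₀).open_source.mem_nhds hy] with z hz
  rw [trivializationAt_snd hz, app_chartField 𝒥 hz, tangentCoord_chartField hz]

theorem extChartAt_mem_target (hy : y ∈ (chartAt E x₀).source) :
    extChartAt 𝓘(ℝ, E) x₀ y ∈ (extChartAt 𝓘(ℝ, E) x₀).target :=
  (extChartAt 𝓘(ℝ, E) x₀).map_source (by simpa using hy)

theorem differentiableAt_chartMetric (hy : y ∈ (chartAt E x₀).source) :
    DifferentiableAt ℝ (chartMetric (E := E) x₀) (extChartAt 𝓘(ℝ, E) x₀ y) :=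
  (contDiffOn_chartMetric x₀).differentiableAt_of_isOpen (isOpen_extChartAt_target x₀)
    (extChartAt_mem_target hy)

theorem differentiableAt_chartJ (𝒥 : AlmostComplexStructure E M) (hy : y ∈ (chartAt E x₀).source) :
    DifferentiableAt ℝ (chartJ 𝒥 x₀) (extChartAt 𝓘(ℝ, E) x₀ y) :=
  (contDiffOn_chartJ 𝒥 x₀).differentiableAt_of_isOpen (isOpen_extChartAt_target x₀)
    (extChartAt_mem_target hy)

theorem chartMetric_pos (hy : y ∈ (chartAt E x₀).source) (u : E) (hu : u ≠ 0) :
    0 < chartMetric x₀ (extChartAt 𝓘(ℝ, E) x₀ y) u u := by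
  rw [← tangentCoord_inverse hy u, chartMetric_tangentCoord hy]
  refine real_inner_self_pos.2 fun h ↦ hu ?_
  rw [← tangentCoord_inverse hy u, h, map_zero]

theorem chartJ_sq (𝒥 : AlmostComplexStructure E M) (hy : y ∈ (chartAt E x₀).source) (u : E) :
    chartJ 𝒥 x₀ (extChartAt 𝓘(ℝ, E) x₀ y) (chartJ 𝒥 x₀ (extChartAt 𝓘(ℝ, E) x₀ y) u) = -u := by
  rw [← tangentCoord_inverse hy u, chartJ_tangentCoord 𝒥 hy, chartJ_tangentCoord 𝒥 hy, 𝒥.sq,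
    map_neg]

theorem chartMetric_J (𝒥 : AlmostHermitianStructure E M) (hy : y ∈ (chartAt E x₀).source)
    (u w : E) :
    chartMetric x₀ (extChartAt 𝓘(ℝ, E) x₀ y)
      (chartJ 𝒥.toAlmostComplexStructure x₀ (extChartAt 𝓘(ℝ, E) x₀ y) u)
      (chartJ 𝒥.toAlmostComplexStructure x₀ (extChartAt 𝓘(ℝ, E) x₀ y) w)
      = chartMetric x₀ (extChartAt 𝓘(ℝ, E) x₀ y) u w := by
  rw [← tangentCoord_inverse hy u, ← tangentCoord_inverse hy w, chartJ_tangentCoord _ hy,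
    chartJ_tangentCoord _ hy, chartMetric_tangentCoord hy, chartMetric_tangentCoord hy,
    𝒥.inner_J_J]

theorem mlieBracket_congr {X X' Y Y' : Π x : M, TangentSpace 𝓘(ℝ, E) x}
    (hX : X =ᶠ[𝓝 y] X') (hY : Y =ᶠ[𝓝 y] Y') :
    mlieBracket 𝓘(ℝ, E) X Y y = mlieBracket 𝓘(ℝ, E) X' Y' y :=
  hX.mlieBracket_vectorField_eq hY

/-- The operator `dbar` in a chart. -/
theorem tangentCoord_dbar (𝒥 : AlmostComplexStructure E M) (hy : y ∈ (chartAt E x₀).source) (u : E)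
    {A : E → E} (hA : DifferentiableAt ℝ A (extChartAt 𝓘(ℝ, E) x₀ y)) :
    tangentCoord x₀ y (dbar 𝒥 (chartField x₀ fun _ ↦ u) (chartField x₀ A) y)
      = (1 / 2 : ℝ) • (fderiv ℝ A (extChartAt 𝓘(ℝ, E) x₀ y) u
          + chartJ 𝒥 x₀ (extChartAt 𝓘(ℝ, E) x₀ y) (fderiv ℝ A (extChartAt 𝓘(ℝ, E) x₀ y)
            (chartJ 𝒥 x₀ (extChartAt 𝓘(ℝ, E) x₀ y) u)))
        + dbarForm (chartJ 𝒥 x₀) (extChartAt 𝓘(ℝ, E) x₀ y) u (A (extChartAt 𝓘(ℝ, E) x₀ y)) := by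
  set p := extChartAt 𝓘(ℝ, E) x₀ y with hp
  have dJ : DifferentiableAt ℝ (chartJ 𝒥 x₀) p := differentiableAt_chartJ 𝒥 hy
  have du : DifferentiableAt ℝ (fun _ : E ↦ u) p := differentiableAt_const u
  have dJu : DifferentiableAt ℝ (fun q ↦ chartJ 𝒥 x₀ q u) p := dJ.clm_apply du
  have dJA : DifferentiableAt ℝ (fun q ↦ chartJ 𝒥 x₀ q (A q)) p := dJ.clm_apply hA
  have eu := app_chartField_eventuallyEq 𝒥 hy (fun _ ↦ u)
  have eA := app_chartField_eventuallyEq 𝒥 hy A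
  rw [dbar, mlieBracket_congr eu eA, mlieBracket_congr eu (EventuallyEq.refl _ (chartField x₀ A)),
    mlieBracket_congr (EventuallyEq.refl _ (chartField x₀ fun _ ↦ u)) eA]
  -- In each of the four brackets the terms differentiating `A` form the first-order part. Those
  -- differentiating only `J` form `dbarForm`.
  simp only [map_smul, map_add, map_sub, ← chartJ_tangentCoord 𝒥 hy]
  rw [mlieBracket_chartField hy du hA, mlieBracket_chartField hy dJu dJA,
    mlieBracket_chartField hy dJu hA, mlieBracket_chartField hy du dJA, ← hp,
    fderiv_clm_apply dJ hA, fderiv_clm_apply dJ du]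
  simp only [fderiv_fun_const, Pi.zero_apply, _root_.zero_apply, _root_.add_apply,
    ContinuousLinearMap.comp_apply, ContinuousLinearMap.flip_apply, map_zero, map_add, map_sub,
    dbarForm]
  rw [chartJ_sq 𝒥 hy]
  module

end
end AlmostHermitian

/-! ### The canonical connection and its curvature in a chart. -/

namespace AlmostHermitian

section
variable {E : Type*} [NormedAddCommGroup E] [NormedSpace ℝ E] [FiniteDimensional ℝ E]
  {M : Type*} [TopologicalSpace M] [ChartedSpace E M] [IsManifold 𝓘(ℝ, E) ∞ M]
  [RiemannianBundle (fun x : M ↦ TangentSpace 𝓘(ℝ, E) x)]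
  [IsContMDiffRiemannianBundle 𝓘(ℝ, E) ∞ E (fun x : M ↦ TangentSpace 𝓘(ℝ, E) x)]
  {x₀ y : M}

theorem mvfderiv_inner_chartField (hy : y ∈ (chartAt E x₀).source) {A B : E → E}
    (hA : DifferentiableAt ℝ A (extChartAt 𝓘(ℝ, E) x₀ y))
    (hB : DifferentiableAt ℝ B (extChartAt 𝓘(ℝ, E) x₀ y)) {X Y : Π x : M, TangentSpace 𝓘(ℝ, E) x}
    (hX : X =ᶠ[𝓝 y] chartField x₀ A) (hY : Y =ᶠ[𝓝 y] chartField x₀ B)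
    (u : TangentSpace 𝓘(ℝ, E) y) :
    mvfderiv 𝓘(ℝ, E) (fun z ↦ (inner ℝ (X z) (Y z) : ℝ)) y u
      = fderiv ℝ (chartMetric x₀) (extChartAt 𝓘(ℝ, E) x₀ y) (tangentCoord x₀ y u)
          (A (extChartAt 𝓘(ℝ, E) x₀ y)) (B (extChartAt 𝓘(ℝ, E) x₀ y))
        + chartMetric x₀ (extChartAt 𝓘(ℝ, E) x₀ y)
          (fderiv ℝ A (extChartAt 𝓘(ℝ, E) x₀ y) (tangentCoord x₀ y u))
          (B (extChartAt 𝓘(ℝ, E) x₀ y))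
        + chartMetric x₀ (extChartAt 𝓘(ℝ, E) x₀ y) (A (extChartAt 𝓘(ℝ, E) x₀ y))
          (fderiv ℝ B (extChartAt 𝓘(ℝ, E) x₀ y) (tangentCoord x₀ y u)) := by
  have dG := differentiableAt_chartMetric hy
  have hev : (fun z ↦ (inner ℝ (X z) (Y z) : ℝ)) =ᶠ[𝓝 y] fun z ↦
      (fun q ↦ chartMetric x₀ q (A q) (B q)) (extChartAt 𝓘(ℝ, E) x₀ z) := by
    filter_upwards [hX, hY, (chartAt E x₀).open_source.mem_nhds hy] with z h1 h2 hz
    rw [h1, h2, inner_chartField hz]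
  have h1 : mvfderiv 𝓘(ℝ, E) (fun z ↦ (inner ℝ (X z) (Y z) : ℝ)) y u
      = mvfderiv 𝓘(ℝ, E) (fun z ↦
      (fun q ↦ chartMetric x₀ q (A q) (B q)) (extChartAt 𝓘(ℝ, E) x₀ z)) y u :=
    congrArg (fun L : E →L[ℝ] ℝ ↦ L u) hev.mfderiv_eq
  rw [h1, mvfderiv_comp_extChartAt hy ((dG.clm_apply hA).clm_apply hB),
    fderiv_clm_apply (dG.clm_apply hA) hB, fderiv_clm_apply dG hA]
  simp only [_root_.add_apply, ContinuousLinearMap.comp_apply, ContinuousLinearMap.flip_apply]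
  ring

variable (𝒥 : AlmostHermitianStructure E M)

/-- The Christoffel symbols of the canonical connection in the chart at `x₀`. -/
noncomputable def chartChristoffel (x₀ : M) : E → E →L[ℝ] E →L[ℝ] E :=
  christoffel (chartMetric x₀) (chartJ 𝒥.toAlmostComplexStructure x₀)

/-- The derivatives of `A` along `J u`, one from the metric term and one from `dbar`, cancel by
skewness of `J`. Those along `u` come as two halves and add up to one term. -/
theorem koszul_chartField (hy : y ∈ (chartAt E x₀).source) (u z : E) {A : E → E}
    (hA : DifferentiableAt ℝ A (extChartAt 𝓘(ℝ, E) x₀ y)) :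
    koszul 𝒥.toAlmostComplexStructure (chartField x₀ fun _ ↦ u) (chartField x₀ A)
        (chartField x₀ fun _ ↦ z) y
      = chartMetric x₀ (extChartAt 𝓘(ℝ, E) x₀ y) (fderiv ℝ A (extChartAt 𝓘(ℝ, E) x₀ y) u) z
        + christoffelForm (chartMetric x₀) (chartJ 𝒥.toAlmostComplexStructure x₀)
          (extChartAt 𝓘(ℝ, E) x₀ y) u (A (extChartAt 𝓘(ℝ, E) x₀ y)) z := by
  have dJ := differentiableAt_chartJ 𝒥.toAlmostComplexStructure hy
  have dz : DifferentiableAt ℝ (fun _ : E ↦ z) (extChartAt 𝓘(ℝ, E) x₀ y) :=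
    differentiableAt_const z
  have skew : ∀ a b : E, chartMetric x₀ (extChartAt 𝓘(ℝ, E) x₀ y)
      (chartJ 𝒥.toAlmostComplexStructure x₀ (extChartAt 𝓘(ℝ, E) x₀ y) a) b
      = - chartMetric x₀ (extChartAt 𝓘(ℝ, E) x₀ y) a
        (chartJ 𝒥.toAlmostComplexStructure x₀ (extChartAt 𝓘(ℝ, E) x₀ y) b) := by
    intro a b
    rw [← chartMetric_J 𝒥 hy (chartJ 𝒥.toAlmostComplexStructure x₀ _ a) b, chartJ_sq _ hy, map_neg,
      _root_.neg_apply]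
  rw [koszul, mvfderiv_inner_chartField hy hA dz (EventuallyEq.refl _ _) (EventuallyEq.refl _ _),
    mvfderiv_inner_chartField hy hA (dJ.clm_apply dz) (EventuallyEq.refl _ _)
      (app_chartField_eventuallyEq _ hy _),
    ← chartMetric_tangentCoord hy, ← chartMetric_tangentCoord hy, tangentCoord_dbar _ hy u hA,
    tangentCoord_dbar _ hy u dz, app_chartField _ hy]
  simp only [tangentCoord_chartField hy]
  rw [fderiv_clm_apply dJ dz]
  simp only [fderiv_fun_const, Pi.zero_apply, _root_.zero_apply, _root_.add_apply,
    ContinuousLinearMap.comp_apply, ContinuousLinearMap.flip_apply, map_zero, map_add, map_smul,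
    _root_.smul_apply, smul_eq_mul, skew, christoffelForm, zero_add, add_zero, smul_zero]
  ring

theorem metric_ext (hy : y ∈ (chartAt E x₀).source) {a b : E}
    (h : ∀ z, chartMetric x₀ (extChartAt 𝓘(ℝ, E) x₀ y) a z
      = chartMetric x₀ (extChartAt 𝓘(ℝ, E) x₀ y) b z) : a = b := by
  by_contra hne
  have := chartMetric_pos hy (a - b) (sub_ne_zero.2 hne)
  rw [map_sub (chartMetric x₀ _), _root_.sub_apply, h, sub_self] at this
  exact lt_irrefl _ this

/-- The canonical connection in a chart. -/
theorem tangentCoord_canonicalConnection (hy : y ∈ (chartAt E x₀).source) {A : E → E}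
    (hA : DifferentiableAt ℝ A (extChartAt 𝓘(ℝ, E) x₀ y)) (v : TangentSpace 𝓘(ℝ, E) y) :
    tangentCoord x₀ y (canonicalConnection 𝒥 (chartField x₀ A) y v)
      = fderiv ℝ A (extChartAt 𝓘(ℝ, E) x₀ y) (tangentCoord x₀ y v)
        + chartChristoffel 𝒥 x₀ (extChartAt 𝓘(ℝ, E) x₀ y) (tangentCoord x₀ y v)
          (A (extChartAt 𝓘(ℝ, E) x₀ y)) := by
  refine metric_ext hy fun z ↦ ?_
  have hv : chartField x₀ (fun _ ↦ tangentCoord x₀ y v) y = v := inverse_tangentCoord hy v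
  have hz := tangentCoord_chartField hy (fun _ ↦ z)
  have key := inner_canonicalConnection (𝒥 := 𝒥)
    (mdifferentiableAt_chartField (A := fun _ ↦ tangentCoord x₀ y v) hy (differentiableAt_const _))
    (mdifferentiableAt_chartField hy hA)
    (mdifferentiableAt_chartField (A := fun _ ↦ z) hy (differentiableAt_const _))
  rw [hv, ← chartMetric_tangentCoord hy, hz, koszul_chartField 𝒥 hy _ _ hA] at key
  rw [key, map_add, _root_.add_apply, chartChristoffel,
    metric_christoffel (isInvertible_of_pos (chartMetric_pos hy))]

/-- On fields with constant coordinates `∇_u w` is `Γ(u, w)` and brackets vanish, so the last three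
identities are the defining properties of the canonical connection evaluated on such fields. -/
theorem localHermitian_chart (x₀ : M) :
    LocalHermitian (extChartAt 𝓘(ℝ, E) x₀).target (chartMetric x₀)
      (chartJ 𝒥.toAlmostComplexStructure x₀) (chartChristoffel 𝒥 x₀) where
  isOpen := isOpen_extChartAt_target x₀
  contDiffOn_metric := contDiffOn_chartMetric x₀
  contDiffOn_J := contDiffOn_chartJ _ x₀
  contDiffOn_christoffel := by
    refine contDiffOn_christoffel (isOpen_extChartAt_target x₀) (contDiffOn_chartMetric x₀)
      (contDiffOn_chartJ _ x₀) fun p hp ↦ ?_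
    obtain ⟨y, hy, rfl, -⟩ := exists_chart_eq hp
    exact isInvertible_of_pos (chartMetric_pos hy)
  symm p hp u w := by
    obtain ⟨y, hy, rfl, -⟩ := exists_chart_eq hp
    rw [← tangentCoord_inverse hy u, ← tangentCoord_inverse hy w, chartMetric_tangentCoord hy,
      chartMetric_tangentCoord hy, real_inner_comm]
  pos p hp := by
    obtain ⟨y, hy, rfl, -⟩ := exists_chart_eq hp
    exact chartMetric_pos hy
  J_sq p hp u := by
    obtain ⟨y, hy, rfl, -⟩ := exists_chart_eq hp
    exact chartJ_sq _ hy u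
  metric_J p hp u w := by
    obtain ⟨y, hy, rfl, -⟩ := exists_chart_eq hp
    exact chartMetric_J 𝒥 hy u w
  metric p hp u w z := by
    obtain ⟨y, hy, rfl, -⟩ := exists_chart_eq hp
    have hm := (isCanonical_canonicalConnection 𝒥).metric
      (mdifferentiableAt_chartField (A := fun _ ↦ w) hy (differentiableAt_const _))
      (mdifferentiableAt_chartField (A := fun _ ↦ z) hy (differentiableAt_const _))
      (chartField x₀ (fun _ ↦ u) y)
    rw [mvfderiv_inner_chartField hy (differentiableAt_const w) (differentiableAt_const z)
      (EventuallyEq.refl _ _) (EventuallyEq.refl _ _), ← chartMetric_tangentCoord hy,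
      ← chartMetric_tangentCoord hy,
      tangentCoord_canonicalConnection 𝒥 hy (differentiableAt_const w),
      tangentCoord_canonicalConnection 𝒥 hy (differentiableAt_const z)] at hm
    simpa [tangentCoord_chartField hy] using hm
  parallel p hp u w := by
    obtain ⟨y, hy, rfl, -⟩ := exists_chart_eq hp
    have dw := mdifferentiableAt_chartField (A := fun _ ↦ w) hy (differentiableAt_const _)
    have dJ := differentiableAt_chartJ 𝒥.toAlmostComplexStructure hy
    have dJw := dJ.clm_apply (differentiableAt_const w)
    have hm := (isCanonical_canonicalConnection 𝒥).parallel dw (chartField x₀ (fun _ ↦ u) y)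
    have hev := app_chartField_eventuallyEq 𝒥.toAlmostComplexStructure hy (fun _ ↦ w)
    -- The field `J w` agrees with its coordinate expression only on the chart domain, which
    -- suffices because a covariant derivative depends only on the germ of the section.
    have hc := (canonicalConnection 𝒥).isCovariantDerivativeOnUniv.congr_of_eventuallyEq
      (mdiff_app 𝒥.toAlmostComplexStructure dw) (mdifferentiableAt_chartField hy dJw)
      univ_mem hev
    have hm' := congrArg (tangentCoord x₀ y)
      ((congrArg (fun L ↦ L (chartField x₀ (fun _ ↦ u) y)) hc).symm.trans hm)
    rw [← chartJ_tangentCoord _ hy, tangentCoord_canonicalConnection 𝒥 hy dJw,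
      tangentCoord_canonicalConnection 𝒥 hy (differentiableAt_const w),
      fderiv_clm_apply dJ (differentiableAt_const w)] at hm'
    simpa [tangentCoord_chartField hy] using hm'
  torsion p hp u w := by
    obtain ⟨y, hy, rfl, -⟩ := exists_chart_eq hp
    have key : ∀ a b : E, tangentCoord x₀ y ((canonicalConnection 𝒥).torsion y
        (chartField x₀ (fun _ ↦ a) y) (chartField x₀ (fun _ ↦ b) y))
        = chartChristoffel 𝒥 x₀ (extChartAt 𝓘(ℝ, E) x₀ y) a b
          - chartChristoffel 𝒥 x₀ (extChartAt 𝓘(ℝ, E) x₀ y) b a := by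
      intro a b
      rw [CovariantDerivative.torsion_apply _
        (mdifferentiableAt_chartField (A := fun _ ↦ a) hy (differentiableAt_const _))
        (mdifferentiableAt_chartField (A := fun _ ↦ b) hy (differentiableAt_const _)),
        map_sub, map_sub, tangentCoord_canonicalConnection 𝒥 hy (differentiableAt_const b),
        tangentCoord_canonicalConnection 𝒥 hy (differentiableAt_const a),
        mlieBracket_chartField hy (differentiableAt_const a) (differentiableAt_const b)]
      simp [tangentCoord_chartField hy]
    have ht := congrArg (tangentCoord x₀ y) ((isCanonical_canonicalConnection 𝒥).torsion y
      (chartField x₀ (fun _ ↦ u) y) (chartField x₀ (fun _ ↦ w) y))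
    have hJ : ∀ a : E, 𝒥.J y (chartField x₀ (fun _ ↦ a) y) = chartField x₀ (fun _ ↦
        chartJ 𝒥.toAlmostComplexStructure x₀ (extChartAt 𝓘(ℝ, E) x₀ y) a) y := fun a ↦
      (app_chartField 𝒥.toAlmostComplexStructure hy (fun _ ↦ a)).trans (chartField_congr rfl)
    rw [hJ, hJ, map_add, key, key, map_zero] at ht
    exact ht

/-- The extensions in `curvature` have constant coordinates near `x`, so the bracket term is zero
and each iterated derivative reduces to `dΓ` plus a product of two `Γ`. -/
theorem tangentCoord_curvature (x : M) (u v w : TangentSpace 𝓘(ℝ, E) x) :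
    tangentCoord x x (curvature (canonicalConnection 𝒥) x u v w)
      = localCurvature (chartChristoffel 𝒥 x) (extChartAt 𝓘(ℝ, E) x x) (tangentCoord x x u)
        (tangentCoord x x v) (tangentCoord x x w) := by
  have hx := mem_chart_source E x
  have hΓ : DifferentiableAt ℝ (chartChristoffel 𝒥 x) (extChartAt 𝓘(ℝ, E) x x) :=
    (localHermitian_chart 𝒥 x).contDiffOn_christoffel.differentiableAt_of_isOpen
      (isOpen_extChartAt_target x) (extChartAt_mem_target hx)
  have hext : ∀ a : TangentSpace 𝓘(ℝ, E) x,
      (extend E a : Π z : M, TangentSpace 𝓘(ℝ, E) z) =ᶠ[𝓝 x] chartField x (fun _ ↦ tangentCoord x x a) := fun a ↦ by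
    filter_upwards [(chartAt E x).open_source.mem_nhds hx] with z hz
      using extend_eq_chartField x a hz
  have hdiff : ∀ (a : TangentSpace 𝓘(ℝ, E) x) {z : M}, z ∈ (chartAt E x).source →
      MDiffAt (T% (extend E a)) z := by
    intro a z hz
    refine (mdifferentiableAt_chartField (A := fun _ ↦ tangentCoord x x a) hz
      (differentiableAt_const _)).congr_of_eventuallyEq ?_
    filter_upwards [(chartAt E x).open_source.mem_nhds hz] with z' hz'
    rw [extend_eq_chartField x a hz']
  have hcov : ∀ (a : TangentSpace 𝓘(ℝ, E) x) {z : M}, z ∈ (chartAt E x).source →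
      canonicalConnection 𝒥 (extend E a) z
        = canonicalConnection 𝒥 (chartField x fun _ ↦ tangentCoord x x a) z := by
    intro a z hz
    refine (canonicalConnection 𝒥).isCovariantDerivativeOnUniv.congr_of_eventuallyEq (hdiff a hz)
      (mdifferentiableAt_chartField hz (differentiableAt_const _)) univ_mem ?_
    filter_upwards [(chartAt E x).open_source.mem_nhds hz] with z' hz'
      using extend_eq_chartField x a hz'
  have hself : ∀ a : TangentSpace 𝓘(ℝ, E) x, extend E a x = a := fun a ↦ extend_apply_self ..
  have h1 : ∀ a b : TangentSpace 𝓘(ℝ, E) x,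
      tangentCoord x x (canonicalConnection 𝒥
        (fun z ↦ canonicalConnection 𝒥 (extend E w) z (extend E b z)) x a)
      = fderiv ℝ (chartChristoffel 𝒥 x) (extChartAt 𝓘(ℝ, E) x x) (tangentCoord x x a)
          (tangentCoord x x b) (tangentCoord x x w)
        + chartChristoffel 𝒥 x (extChartAt 𝓘(ℝ, E) x x) (tangentCoord x x a)
          (chartChristoffel 𝒥 x (extChartAt 𝓘(ℝ, E) x x) (tangentCoord x x b)
            (tangentCoord x x w)) := by
    intro a b
    have hA : DifferentiableAt ℝ
        (fun p ↦ chartChristoffel 𝒥 x p (tangentCoord x x b) (tangentCoord x x w))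
        (extChartAt 𝓘(ℝ, E) x x) :=
      (hΓ.clm_apply (differentiableAt_const _)).clm_apply (differentiableAt_const _)
    -- The inner derivative must be identified on a whole neighbourhood, since it is differentiated
    -- again.
    have hev : (fun z ↦ canonicalConnection 𝒥 (extend E w) z (extend E b z)) =ᶠ[𝓝 x]
        chartField x
          (fun p ↦ chartChristoffel 𝒥 x p (tangentCoord x x b) (tangentCoord x x w)) := by
      filter_upwards [(chartAt E x).open_source.mem_nhds hx] with z hz
      apply tangentCoord_injective hz
      rw [hcov w hz, tangentCoord_canonicalConnection 𝒥 hz (differentiableAt_const _),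
        extend_eq_chartField x b hz, tangentCoord_chartField hz, tangentCoord_chartField hz]
      simp
    have hd := mdifferentiableAt_chartField hx hA
    have hc := (canonicalConnection 𝒥).isCovariantDerivativeOnUniv.congr_of_eventuallyEq
      (hd.congr_of_eventuallyEq (hev.mono fun z hz ↦ congrArg (TotalSpace.mk' E z) hz)) hd univ_mem hev
    have hc' := congrArg (fun L ↦ tangentCoord x x (L a)) hc
    refine Eq.trans hc' ?_
    rw [tangentCoord_canonicalConnection 𝒥 hx hA,
      fderiv_clm_apply (hΓ.clm_apply (differentiableAt_const _)) (differentiableAt_const _),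
      fderiv_clm_apply hΓ (differentiableAt_const _)]
    simp
  have h2 : mlieBracket 𝓘(ℝ, E) (extend E u) (extend E v) x = 0 := by
    apply tangentCoord_injective hx
    rw [mlieBracket_congr (hext u) (hext v),
      mlieBracket_chartField hx (differentiableAt_const _) (differentiableAt_const _)]
    simp
  rw [curvature, curvatureField, h2, map_zero, sub_zero, map_sub, hself, hself, h1, h1,
    localCurvature]
  abel

end
end AlmostHermitian

/-! ### The map `f` in charts. -/

namespace AlmostHermitian

section
variable {E : Type*} [NormedAddCommGroup E] [NormedSpace ℝ E]
  {M : Type*} [TopologicalSpace M] [ChartedSpace E M] [IsManifold 𝓘(ℝ, E) ∞ M]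
  {F : Type*} [NormedAddCommGroup F] [NormedSpace ℝ F]
  {N : Type*} [TopologicalSpace N] [ChartedSpace F N] [IsManifold 𝓘(ℝ, F) ∞ N]

/-- The map `f` in the charts at `x₀` and `f x₀`. -/
noncomputable def chartMap (E : Type*) [NormedAddCommGroup E] [NormedSpace ℝ E] {M : Type*} [TopologicalSpace M]
    [ChartedSpace E M] (F : Type*) [NormedAddCommGroup F] [NormedSpace ℝ F] {N : Type*}
    [TopologicalSpace N] [ChartedSpace F N] (f : M → N) (x₀ : M) (p : E) : F :=
  extChartAt 𝓘(ℝ, F) (f x₀) (f ((extChartAt 𝓘(ℝ, E) x₀).symm p))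

/-- The domain of `chartMap`. -/
def chartMapDomain (E : Type*) [NormedAddCommGroup E] [NormedSpace ℝ E] {M : Type*}
    [TopologicalSpace M] [ChartedSpace E M] (F : Type*) [NormedAddCommGroup F] [NormedSpace ℝ F]
    {N : Type*} [TopologicalSpace N] [ChartedSpace F N] (f : M → N) (x₀ : M) : Set E :=
  (extChartAt 𝓘(ℝ, E) x₀).target ∩
    (extChartAt 𝓘(ℝ, E) x₀).symm ⁻¹' (f ⁻¹' (chartAt F (f x₀)).source)

variable {f : M → N} {x₀ y : M}

theorem isOpen_chartMapDomain (hf : Continuous f) (x₀ : M) :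
    IsOpen (chartMapDomain E F f x₀) :=
  (continuousOn_extChartAt_symm x₀).isOpen_inter_preimage (isOpen_extChartAt_target x₀)
    ((chartAt F (f x₀)).open_source.preimage hf)

theorem contDiffOn_chartMap (hf : ContMDiff 𝓘(ℝ, E) 𝓘(ℝ, F) ∞ f) (x₀ : M) :
    ContDiffOn ℝ ∞ (chartMap E F f x₀) (chartMapDomain E F f x₀) := by
  rw [← contMDiffOn_iff_contDiffOn]
  exact (contMDiffOn_extChartAt (I := 𝓘(ℝ, F)) (x := f x₀)).comp
    (hf.comp_contMDiffOn ((contMDiffOn_extChartAt_symm x₀).mono inter_subset_left))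
    fun p hp ↦ hp.2

theorem mem_chartMapDomain (hy : y ∈ (chartAt E x₀).source)
    (hfy : f y ∈ (chartAt F (f x₀)).source) :
    extChartAt 𝓘(ℝ, E) x₀ y ∈ chartMapDomain E F f x₀ := by
  refine ⟨(extChartAt 𝓘(ℝ, E) x₀).map_source (by simpa using hy), ?_⟩
  have e : (extChartAt 𝓘(ℝ, E) x₀).symm (extChartAt 𝓘(ℝ, E) x₀ y) = y :=
    (extChartAt 𝓘(ℝ, E) x₀).left_inv (by simpa using hy)
  rwa [mem_preimage, mem_preimage, e]

theorem exists_of_mem_chartMapDomain {p : E} (hp : p ∈ chartMapDomain E F f x₀) :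
    ∃ y, y ∈ (chartAt E x₀).source ∧ f y ∈ (chartAt F (f x₀)).source ∧
      extChartAt 𝓘(ℝ, E) x₀ y = p :=
  ⟨(extChartAt 𝓘(ℝ, E) x₀).symm p, by simpa using (extChartAt 𝓘(ℝ, E) x₀).map_target hp.1, hp.2,
    (extChartAt 𝓘(ℝ, E) x₀).right_inv hp.1⟩

theorem chartMap_extChartAt (hy : y ∈ (chartAt E x₀).source) :
    chartMap E F f x₀ (extChartAt 𝓘(ℝ, E) x₀ y) = extChartAt 𝓘(ℝ, F) (f x₀) (f y) := by
  have e : (extChartAt 𝓘(ℝ, E) x₀).symm (extChartAt 𝓘(ℝ, E) x₀ y) = y :=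
    (extChartAt 𝓘(ℝ, E) x₀).left_inv (by simpa using hy)
  rw [chartMap, e]

theorem fderiv_chartMap (hf : ContMDiff 𝓘(ℝ, E) 𝓘(ℝ, F) ∞ f) (hy : y ∈ (chartAt E x₀).source)
    (hfy : f y ∈ (chartAt F (f x₀)).source) (v : TangentSpace 𝓘(ℝ, E) y) :
    fderiv ℝ (chartMap E F f x₀) (extChartAt 𝓘(ℝ, E) x₀ y) (tangentCoord x₀ y v)
      = tangentCoord (f x₀) (f y) (mfderiv 𝓘(ℝ, E) 𝓘(ℝ, F) f y v) := by
  have hd : DifferentiableAt ℝ (chartMap E F f x₀) (extChartAt 𝓘(ℝ, E) x₀ y) :=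
    (contDiffOn_chartMap hf x₀).differentiableAt_of_isOpen (isOpen_chartMapDomain hf.continuous x₀)
      (mem_chartMapDomain hy hfy)
  have h1 := hd.hasFDerivAt.hasMFDerivAt.comp y
    (mdifferentiableAt_extChartAt (I := 𝓘(ℝ, E)) hy).hasMFDerivAt
  have h2 := (mdifferentiableAt_extChartAt (I := 𝓘(ℝ, F)) hfy).hasMFDerivAt.comp y
    (hf.mdifferentiable (by simp) y).hasMFDerivAt
  have hev : (extChartAt 𝓘(ℝ, F) (f x₀)) ∘ f
      =ᶠ[𝓝 y] (chartMap E F f x₀) ∘ (extChartAt 𝓘(ℝ, E) x₀) := by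
    filter_upwards [(chartAt E x₀).open_source.mem_nhds hy] with z hz
    exact (chartMap_extChartAt hz).symm
  have h3 := hasMFDerivAt_unique (h1.congr_of_eventuallyEq hev) h2
  exact congrArg (fun L : E →L[ℝ] F ↦ L v) h3

end

/-! ### Existence of a direction of maximal stretching, and comparison of the curvatures there. -/

section
variable {E : Type*} [NormedAddCommGroup E] [NormedSpace ℝ E] [FiniteDimensional ℝ E]
  {M : Type*} [TopologicalSpace M] [ChartedSpace E M] [IsManifold 𝓘(ℝ, E) ∞ M]
  [RiemannianBundle (fun x : M ↦ TangentSpace 𝓘(ℝ, E) x)]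
  [IsContMDiffRiemannianBundle 𝓘(ℝ, E) ∞ E (fun x : M ↦ TangentSpace 𝓘(ℝ, E) x)]
  {F : Type*} [NormedAddCommGroup F] [NormedSpace ℝ F] [FiniteDimensional ℝ F]
  {N : Type*} [TopologicalSpace N] [ChartedSpace F N] [IsManifold 𝓘(ℝ, F) ∞ N]
  [RiemannianBundle (fun y : N ↦ TangentSpace 𝓘(ℝ, F) y)]
  [IsContMDiffRiemannianBundle 𝓘(ℝ, F) ∞ F (fun y : N ↦ TangentSpace 𝓘(ℝ, F) y)]
  {f : M → N}

/-- `lam` is attained as the square of a stretching factor of `f` and bounds those on `s`. -/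
def IsAttainedStretchBound (E : Type*) [NormedAddCommGroup E] [NormedSpace ℝ E] {M : Type*}
    [TopologicalSpace M] [ChartedSpace E M] [IsManifold 𝓘(ℝ, E) ∞ M]
    [RiemannianBundle (fun x : M ↦ TangentSpace 𝓘(ℝ, E) x)]
    (F : Type*) [NormedAddCommGroup F] [NormedSpace ℝ F] {N : Type*}
    [TopologicalSpace N] [ChartedSpace F N] [IsManifold 𝓘(ℝ, F) ∞ N]
    [RiemannianBundle (fun y : N ↦ TangentSpace 𝓘(ℝ, F) y)]
    (f : M → N) (s : Set M) (lam : ℝ) : Prop :=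
  (∃ (x : M) (v : TangentSpace 𝓘(ℝ, E) x), v ≠ 0 ∧
    inner ℝ (mfderiv 𝓘(ℝ, E) 𝓘(ℝ, F) f x v) (mfderiv 𝓘(ℝ, E) 𝓘(ℝ, F) f x v) = lam * inner ℝ v v) ∧
  ∀ x ∈ s, ∀ v : TangentSpace 𝓘(ℝ, E) x,
    inner ℝ (mfderiv 𝓘(ℝ, E) 𝓘(ℝ, F) f x v) (mfderiv 𝓘(ℝ, E) 𝓘(ℝ, F) f x v) ≤ lam * inner ℝ v v

theorem inner_mfderiv (hf : ContMDiff 𝓘(ℝ, E) 𝓘(ℝ, F) ∞ f) {x₀ y : M}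
    (hy : y ∈ (chartAt E x₀).source) (hfy : f y ∈ (chartAt F (f x₀)).source)
    (v : TangentSpace 𝓘(ℝ, E) y) :
    inner ℝ (mfderiv 𝓘(ℝ, E) 𝓘(ℝ, F) f y v) (mfderiv 𝓘(ℝ, E) 𝓘(ℝ, F) f y v)
      = chartMetric (f x₀) (chartMap E F f x₀ (extChartAt 𝓘(ℝ, E) x₀ y))
          (fderiv ℝ (chartMap E F f x₀) (extChartAt 𝓘(ℝ, E) x₀ y) (tangentCoord x₀ y v))
          (fderiv ℝ (chartMap E F f x₀) (extChartAt 𝓘(ℝ, E) x₀ y) (tangentCoord x₀ y v)) := by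
  rw [fderiv_chartMap hf hy hfy, chartMap_extChartAt hy, chartMetric_tangentCoord hfy]

/-- In coordinates the squared stretching factor is continuous on (closed ball) × (unit sphere), a
compact set, so it has a maximum there. `Nontrivial E` makes the sphere nonempty. -/
theorem exists_local_isAttainedStretchBound [Nontrivial E] (hf : ContMDiff 𝓘(ℝ, E) 𝓘(ℝ, F) ∞ f)
    (x₀ : M) : ∃ s ∈ 𝓝 x₀, ∃ lam, IsAttainedStretchBound E F f s lam := by
  set V := chartMapDomain E F f x₀
  have hV : IsOpen V := isOpen_chartMapDomain hf.continuous x₀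
  have hx₀ := mem_chart_source E x₀
  have hp₀ : extChartAt 𝓘(ℝ, E) x₀ x₀ ∈ V := mem_chartMapDomain hx₀ (mem_chart_source F _)
  obtain ⟨ε, hε, hεV⟩ := Metric.nhds_basis_closedBall.mem_iff.1 (hV.mem_nhds hp₀)
  set K : Set (E × E) := Metric.closedBall (extChartAt 𝓘(ℝ, E) x₀ x₀) ε ×ˢ Metric.sphere 0 1
  have : ProperSpace E := FiniteDimensional.proper_real E
  have hK : IsCompact K := (isCompact_closedBall _ _).prod (isCompact_sphere _ _)
  obtain ⟨u₀, hu₀⟩ : (Metric.sphere (0 : E) 1).Nonempty := NormedSpace.sphere_nonempty.2 zero_le_one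
  have hKne : K.Nonempty := ⟨(_, u₀), Metric.mem_closedBall_self hε.le, hu₀⟩
  set φ := chartMap E F f x₀ with hφ
  have hφs : ContDiffOn ℝ ∞ φ V := contDiffOn_chartMap hf x₀
  have hKV : MapsTo Prod.fst K V := fun q hq ↦ hεV hq.1
  have hφU : MapsTo φ V (extChartAt 𝓘(ℝ, F) (f x₀)).target := by
    intro p hp
    obtain ⟨y, hy, hfy, rfl⟩ := exists_of_mem_chartMapDomain hp
    rw [hφ, chartMap_extChartAt hy]
    exact extChartAt_mem_target hfy
  have cG : ContinuousOn (fun q : E × E ↦ chartMetric x₀ q.1 q.2 q.2) K :=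
    ((((contDiffOn_chartMetric x₀).continuousOn.mono inter_subset_left).comp continuousOn_fst
      hKV).clm_apply continuousOn_snd).clm_apply continuousOn_snd
  have cD : ContinuousOn (fun q : E × E ↦ fderiv ℝ φ q.1 q.2) K :=
    ((hφs.fderiv_of_isOpen hV (m := ∞) (by simp)).continuousOn.comp continuousOn_fst
      hKV).clm_apply continuousOn_snd
  have cG' : ContinuousOn (fun q : E × E ↦ chartMetric (f x₀) (φ q.1) (fderiv ℝ φ q.1 q.2)
      (fderiv ℝ φ q.1 q.2)) K :=
    (((((contDiffOn_chartMetric (f x₀)).continuousOn.comp hφs.continuousOn hφU).comp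
      continuousOn_fst hKV)).clm_apply cD).clm_apply cD
  have hGpos : ∀ q ∈ V, ∀ u ≠ 0, 0 < chartMetric x₀ q u u := by
    intro q hq u hu
    obtain ⟨y, hy, -, rfl⟩ := exists_of_mem_chartMapDomain hq
    exact chartMetric_pos hy u hu
  have hsph : ∀ u ∈ Metric.sphere (0 : E) 1, u ≠ 0 := fun u hu ↦ ne_zero_of_mem_unit_sphere ⟨u, hu⟩
  obtain ⟨⟨p, u⟩, hpu, hmax⟩ := hK.exists_isMaxOn hKne
    (cG'.div cG fun q hq ↦ (hGpos _ (hKV hq) _ (hsph _ hq.2)).ne')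
  refine ⟨(chartAt E x₀).source ∩ extChartAt 𝓘(ℝ, E) x₀ ⁻¹'
    Metric.closedBall (extChartAt 𝓘(ℝ, E) x₀ x₀) ε, ?_,
    chartMetric (f x₀) (φ p) (fderiv ℝ φ p u) (fderiv ℝ φ p u) / chartMetric x₀ p u u, ?_, ?_⟩
  · exact inter_mem ((chartAt E x₀).open_source.mem_nhds hx₀)
      ((continuousAt_extChartAt x₀).preimage_mem_nhds (Metric.closedBall_mem_nhds _ hε))
  · obtain ⟨y, hy, hfy, hyp⟩ := exists_of_mem_chartMapDomain (hKV hpu)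
    replace hyp : extChartAt 𝓘(ℝ, E) x₀ y = p := hyp
    have hu : u ≠ 0 := hsph u hpu.2
    refine ⟨y, (tangentCoord x₀ y).inverse u, ?_, ?_⟩
    · intro h
      apply hu
      rw [← tangentCoord_inverse hy u, h, map_zero]
    · rw [inner_mfderiv hf hy hfy, ← chartMetric_tangentCoord hy, tangentCoord_inverse hy, hyp,
        div_mul_cancel₀ _ (hGpos p (hKV hpu) u hu).ne']
  · rintro y ⟨hy, hyB⟩ v
    have hyV : extChartAt 𝓘(ℝ, E) x₀ y ∈ V := hεV hyB
    have hfy : f y ∈ (chartAt F (f x₀)).source := by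
      have h := hyV.2
      have e : (extChartAt 𝓘(ℝ, E) x₀).symm (extChartAt 𝓘(ℝ, E) x₀ y) = y :=
        (extChartAt 𝓘(ℝ, E) x₀).left_inv (by simpa using hy)
      rwa [mem_preimage, mem_preimage, e] at h
    rw [inner_mfderiv hf hy hfy, ← chartMetric_tangentCoord hy]
    set w := tangentCoord x₀ y v
    rcases eq_or_ne w 0 with hw | hw
    · simp [hw]
    · have hwn : ‖w‖ ≠ 0 := norm_ne_zero_iff.2 hw
      -- The quotient is homogeneous of degree zero in `w`, so the bound on unit vectors covers all
      -- nonzero ones.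
      have hmem : (extChartAt 𝓘(ℝ, E) x₀ y, ‖w‖⁻¹ • w) ∈ K :=
        ⟨hyB, by simp [norm_smul, inv_mul_cancel₀ hwn]⟩
      have h := hmax hmem
      simp only [Set.mem_ofPred_eq, Pi.div_apply, map_smul, _root_.smul_apply, smul_eq_mul] at h
      rw [mul_div_mul_left _ _ (inv_ne_zero hwn), mul_div_mul_left _ _ (inv_ne_zero hwn)] at h
      exact (div_le_iff₀ (hGpos _ hyV w hw)).1 h

/-- The local bounds are glued by compactness. The maximizing point need not lie in `s`, so a bound
passes to subsets, and the larger of two bounds serves for a union. -/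
theorem exists_isAttainedStretchBound [Nontrivial E] [CompactSpace M] [Nonempty M]
    (hf : ContMDiff 𝓘(ℝ, E) 𝓘(ℝ, F) ∞ f) : ∃ lam, IsAttainedStretchBound E F f univ lam := by
  refine isCompact_univ.induction_on (p := fun s ↦ ∃ lam, IsAttainedStretchBound E F f s lam)
    ?_ ?_ ?_ ?_
  · obtain ⟨x⟩ := ‹Nonempty M›
    obtain ⟨-, -, lam, h, -⟩ := exists_local_isAttainedStretchBound hf x
    exact ⟨lam, h, fun x hx ↦ hx.elim⟩
  · rintro s t hst ⟨lam, h1, h2⟩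
    exact ⟨lam, h1, fun x hx ↦ h2 x (hst hx)⟩
  · rintro s t ⟨lam, h1, h2⟩ ⟨mu, h3, h4⟩
    have mono : ∀ {a b : ℝ} {x : M} (v : TangentSpace 𝓘(ℝ, E) x), a ≤ b →
        a * (inner ℝ v v : ℝ) ≤ b * inner ℝ v v :=
      fun v hab ↦ mul_le_mul_of_nonneg_right hab real_inner_self_nonneg
    rcases le_total lam mu with h | h
    · exact ⟨mu, h3, fun x hx v ↦ hx.elim (fun hs ↦ (h2 x hs v).trans (mono v h)) (h4 x · v)⟩
    · exact ⟨lam, h1, fun x hx v ↦ hx.elim (h2 x · v) (fun hs ↦ (h4 x hs v).trans (mono v h))⟩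
  · intro x _
    obtain ⟨s, hs, lam, h⟩ := exists_local_isAttainedStretchBound hf x
    exact ⟨s, nhdsWithin_le_nhds hs, lam, h⟩

/-- The curvatures in a direction which an almost holomorphic map stretches the most. -/
theorem curvature_comparison (𝒥 : AlmostHermitianStructure E M) (𝒥' : AlmostHermitianStructure F N)
    (hf : IsAlmostHolomorphic 𝒥.toAlmostComplexStructure 𝒥'.toAlmostComplexStructure f) {lam : ℝ}
    (hlam : ∀ (x : M) (v : TangentSpace 𝓘(ℝ, E) x),
      inner ℝ (mfderiv 𝓘(ℝ, E) 𝓘(ℝ, F) f x v) (mfderiv 𝓘(ℝ, E) 𝓘(ℝ, F) f x v) ≤ lam * inner ℝ v v)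
    (x : M) (v : TangentSpace 𝓘(ℝ, E) x)
    (heq : inner ℝ (mfderiv 𝓘(ℝ, E) 𝓘(ℝ, F) f x v) (mfderiv 𝓘(ℝ, E) 𝓘(ℝ, F) f x v)
      = lam * inner ℝ v v) :
    lam * inner ℝ (curvature (canonicalConnection 𝒥) x v (𝒥.J x v) (𝒥.J x v)) v
      ≤ inner ℝ (curvature (canonicalConnection 𝒥') (f x) (mfderiv 𝓘(ℝ, E) 𝓘(ℝ, F) f x v)
          (𝒥'.J (f x) (mfderiv 𝓘(ℝ, E) 𝓘(ℝ, F) f x v))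
          (𝒥'.J (f x) (mfderiv 𝓘(ℝ, E) 𝓘(ℝ, F) f x v)))
          (mfderiv 𝓘(ℝ, E) 𝓘(ℝ, F) f x v) := by
  have hx := mem_chart_source E x
  have hfx := mem_chart_source F (f x)
  have h := (localHermitian_chart 𝒥 x).curvature_comparison (localHermitian_chart 𝒥' (f x))
    (isOpen_chartMapDomain (E := E) (F := F) hf.1.continuous x) inter_subset_left
    (contDiffOn_chartMap hf.1 x) (lam := lam) (p₀ := extChartAt 𝓘(ℝ, E) x x)
    (v := tangentCoord x x v) ?_ ?_ ?_ (mem_chartMapDomain hx hfx) ?_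
  · rwa [fderiv_chartMap hf.1 hx hfx, chartMap_extChartAt hx, chartJ_tangentCoord _ hx,
      chartJ_tangentCoord _ hfx, ← tangentCoord_curvature, ← tangentCoord_curvature,
      chartMetric_tangentCoord hx, chartMetric_tangentCoord hfx] at h
  · intro p hp
    obtain ⟨y, hy, hfy, rfl⟩ := exists_of_mem_chartMapDomain hp
    rw [chartMap_extChartAt hy]
    exact extChartAt_mem_target hfy
  · intro p hp u
    obtain ⟨y, hy, hfy, rfl⟩ := exists_of_mem_chartMapDomain hp
    rw [← tangentCoord_inverse hy u, chartJ_tangentCoord _ hy, fderiv_chartMap hf.1 hy hfy,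
      fderiv_chartMap hf.1 hy hfy, chartMap_extChartAt hy, chartJ_tangentCoord _ hfy, hf.2]
  · intro p hp u
    obtain ⟨y, hy, hfy, rfl⟩ := exists_of_mem_chartMapDomain hp
    rw [← tangentCoord_inverse hy u, ← inner_mfderiv hf.1 hy hfy, chartMetric_tangentCoord hy]
    exact hlam y _
  · rw [← inner_mfderiv hf.1 hx hfx, chartMetric_tangentCoord hx, heq]

end
end AlmostHermitian

/-! ### Conclusion: the curvature bounds at a maximally stretched direction. -/

theorem corollary1p5
    {E : Type*} [NormedAddCommGroup E] [NormedSpace ℝ E] [FiniteDimensional ℝ E]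
    {M : Type*} [TopologicalSpace M] [ChartedSpace E M] [IsManifold 𝓘(ℝ, E) ∞ M]
    [T2Space M] [CompactSpace M]
    [RiemannianBundle (fun x : M ↦ TangentSpace 𝓘(ℝ, E) x)]
    [IsContMDiffRiemannianBundle 𝓘(ℝ, E) ∞ E (fun x : M ↦ TangentSpace 𝓘(ℝ, E) x)]
    (𝒥 : AlmostHermitian.AlmostHermitianStructure E M)
    {F : Type*} [NormedAddCommGroup F] [NormedSpace ℝ F] [FiniteDimensional ℝ F]
    {N : Type*} [TopologicalSpace N] [ChartedSpace F N] [IsManifold 𝓘(ℝ, F) ∞ N]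
    [T2Space N] [SecondCountableTopology N]
    [RiemannianBundle (fun y : N ↦ TangentSpace 𝓘(ℝ, F) y)]
    [IsContMDiffRiemannianBundle 𝓘(ℝ, F) ∞ F (fun y : N ↦ TangentSpace 𝓘(ℝ, F) y)]
    (𝒥' : AlmostHermitian.AlmostHermitianStructure F N)
    (k₁ k₂ : ℝ) (hk₁ : 0 ≤ k₁) (hk₂ : 0 < k₂)
    (hM : ∀ (x : M) (v : TangentSpace 𝓘(ℝ, E) x), v ≠ 0 →
      -k₁ ≤ AlmostHermitian.holSecCurv 𝒥 x v)
    (hN : ∀ (y : N) (w : TangentSpace 𝓘(ℝ, F) y), w ≠ 0 →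
      AlmostHermitian.holSecCurv 𝒥' y w ≤ -k₂)
    (f : M → N)
    (hf : AlmostHermitian.IsAlmostHolomorphic 𝒥.toAlmostComplexStructure
      𝒥'.toAlmostComplexStructure f) :
    ∀ (x : M) (v : TangentSpace 𝓘(ℝ, E) x),
      inner ℝ (mfderiv 𝓘(ℝ, E) 𝓘(ℝ, F) f x v) (mfderiv 𝓘(ℝ, E) 𝓘(ℝ, F) f x v)
        ≤ k₁ / k₂ * inner ℝ v v := by
  intro x v
  -- In dimension zero there is no nonzero vector at which a maximum could be attained.
  rcases subsingleton_or_nontrivial E with hE | hE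
  · have hv : v = 0 := hE.elim (α := E) v 0
    rw [hv, map_zero, inner_zero_left, inner_zero_left, mul_zero]
  have : Nonempty M := ⟨x⟩
  obtain ⟨lam, ⟨x₀, v₀, hv₀, heq⟩, hle⟩ :=
    AlmostHermitian.exists_isAttainedStretchBound (E := E) (F := F) hf.1
  refine (hle x (mem_univ x) v).trans (mul_le_mul_of_nonneg_right ?_ real_inner_self_nonneg)
  -- For `lam > 0` the image `w` of `v₀` is nonzero, so that the bound on the curvature of `N`
  -- applies to it.
  rcases le_or_gt lam 0 with hlam | hlam
  · exact hlam.trans (div_nonneg hk₁ hk₂.le)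
  have hc := AlmostHermitian.curvature_comparison 𝒥 𝒥' hf (fun x v ↦ hle x (mem_univ x) v) x₀ v₀ heq
  set w := mfderiv 𝓘(ℝ, E) 𝓘(ℝ, F) f x₀ v₀
  have hpos : (0 : ℝ) < inner ℝ v₀ v₀ := real_inner_self_pos.2 hv₀
  have hpos' : (0 : ℝ) < inner ℝ w w := heq ▸ mul_pos hlam hpos
  have h1 := hM x₀ v₀ hv₀
  have h2 := hN (f x₀) w (real_inner_self_pos.1 hpos')
  rw [AlmostHermitian.holSecCurv, le_div_iff₀ (pow_pos hpos 2)] at h1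
  rw [AlmostHermitian.holSecCurv, div_le_iff₀ (pow_pos hpos' 2), heq] at h2
  rw [le_div_iff₀ hk₂]
  have h3 := mul_le_mul_of_nonneg_left h1 hlam.le
  -- This is the chain `-lam k₁ |v₀|⁴ ≤ lam · g(R(v₀, J v₀) J v₀, v₀) ≤ g'(R'(w, J' w) J' w, w) ≤
  -- -k₂ |w|⁴` with `|w|² = lam |v₀|²`.
  have h4 : lam * (k₂ * lam) * (inner ℝ v₀ v₀ : ℝ) ^ 2 ≤ lam * k₁ * (inner ℝ v₀ v₀ : ℝ) ^ 2 := by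
    linarith
  have h5 := le_of_mul_le_mul_left (le_of_mul_le_mul_right h4 (pow_pos hpos 2)) hlam
  linarith
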